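/- **Theorem (Quantum linear system algorithm with optimal coefficient block encoding).** All norms are Euclidean / spectral. For $\alpha_A,\alpha_{A^{-1}}>0$ write $\kappa=\alpha_A\alpha_{A^{-1}}$, and assume $\kappa\ge 1$ (which is automatic for $\alpha_A\ge\|A\|$, $\alpha_{A^{-1}}\ge\|A^{-1}\|$). For every constant $c>1$ there is a constant $K>0$, depending only on $c$, such that the following holds for all dimensions $d\ge 1$ and $D$, all isometries $G:\mathbb C^d\to\mathbb C^D$, all $\alpha_A,\alpha_{A^{-1}}>0$ with $\kappa\ge1$, all $t>0$ and all $\epsilon\in(0,\tfrac12]$. There is a quantum algorithm, depending only on these data, which queries two unitary oracles $O_A$ (on $\mathbb C^D$) and $O_b$ (on $\mathbb C^d$), their inverses and controlled versions, at most $$K\,\kappa\log(1/\epsilon)\ \text{times for } O_A\qquad\text{and at most}\qquad K\,\kappa\log(1/\epsilon)\ \text{times for } O_b ,$$ and which satisfies the following for every invertible $A\in\mathbb C^{d\times d}$ and all oracles such that $A/\alpha_A=G^\dagger O_AG$ (so $\|A\|\le\alpha_A$), $\|A^{-1}\|\le\alpha_{A^{-1}}$, $O_b|0\rangle=|b\rangle$,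 and $t$ is a constant multiplicative estimate of the solution norm, $$\frac tc<\big\|A^{-1}|b\rangle\big\|<c\,t .$$ The algorithm prepares the state $A^{-1}|b\rangle/\|A^{-1}|b\rangle\|$ to accuracy $\epsilon$ with success probability $>\frac12$: run on $|0\rangle|0\rangle$ (system and workspace), a measurement of the workspace gives $|0\rangle$ with probability $>\frac12$, and then the normalized state of the system is within Euclidean distance $\epsilon$ of that state. The algorithm works by block preconditioning. Let $s=\frac{t}{c\,\alpha_{A^{-1}}}$, $S=s|b\rangle\langle b|+(I-|b\rangle\langle b|)$ and $\sqrt{p_{\rm succ}}=\|A^{-1}|b\rangle\|/\alpha_{A^{-1}}$. Then $\frac{1}{c^2}\sqrt{p_{\rm succ}}<s<\sqrt{p_{\rm succ}}$ and $s<1$; $SA$ is invertible, $(SA)^{-1}|b\rangle$ and $A^{-1}|b\rangle$ have the same normalization, and $\|(SA)^{-1}\|\le\sqrt{c^4+1}\,\alpha_{A^{-1}}$. The algorithm is the composition of three circuits: (1) a circuit with one query to $O_A$ and two queries to $O_b$ or its inverse that block encodes $SA/\alpha_A$; (2) a quantum singular value transformation sequence of odd length, with phases independent of $A$ and $|b\rangle$,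 which queries (1) and its inverse alternately and block encodes $\frac{(SA)^{-1}}{2\sqrt{c^4+1}\,\alpha_{A^{-1}}}$ with accuracy $\epsilon$ in spectral norm; (3) a circuit which queries (2) and $O_b$ and prepares the solution state. (For $c=2$: $s=t/(2\alpha_{A^{-1}})$ and $\sqrt{c^4+1}=\sqrt{17}$.) -/

import Mathlib

open Matrix

open scoped Matrix.Norms.L2Operator

namespace QLS

noncomputable section

/-- Euclidean norm of a complex vector. -/
def norm2 {n : Type} [Fintype n] (v : n → ℂ) : ℝ := ‖WithLp.toLp 2 v‖

/-- The unit vector `v / ‖v‖`. -/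
def unitVec {n : Type} [Fintype n] (v : n → ℂ) : n → ℂ := ((norm2 v : ℂ))⁻¹ • v

/-- `G` is an isometry: `G† G = I`. -/
def IsIso {m n : Type} [Fintype m] [DecidableEq n] (G : Matrix m n ℂ) : Prop := Gᴴ * G = 1

/-- The unitary `U` and the isometry `G` block encode `A / α`: `A / α = G† U G`. -/
def BlockEncodes {m n : Type} [Fintype m] [DecidableEq m] [Fintype n] [DecidableEq n]
    (G : Matrix m n ℂ) (U : Matrix m m ℂ) (α : ℝ) (A : Matrix n n ℂ) : Prop :=
  IsIso G ∧ U ∈ Matrix.unitaryGroup m ℂ ∧ (α : ℂ)⁻¹ • A = Gᴴ * U * G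

/-- The scaling operator `S = s |b⟩⟨b| + (I - |b⟩⟨b|)`. -/
def scaling {n : Type} [DecidableEq n] (s : ℝ) (b : n → ℂ) : Matrix n n ℂ :=
  (s : ℂ) • vecMulVec b (star b) + (1 - vecMulVec b (star b))

/-! ### Quantum query circuits

A circuit acts on the Hilbert space with orthonormal basis `X`. It has black-box access to two
unitaries, the first one acting on a register with basis `m` and the second one on a register with
basis `n`. A gate is a fixed unitary, or one (possibly controlled, possibly inverse) query. -/

/-- `U` acting on the first tensor factor, controlled on the second factor being in a basis state
of `c`. With `c = univ` this is `U ⊗ I`. -/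
def controlled {m : Type} [DecidableEq m] {r : ℕ} (c : Finset (Fin r)) (U : Matrix m m ℂ) :
    Matrix (m × Fin r) (m × Fin r) ℂ :=
  blockDiagonal fun j => if j ∈ c then U else 1

/-- The controlled operator of `controlled`, on a space `X` that is identified by `e` with the
tensor product of the register `m` and the remaining `r`-dimensional register. -/
def onReg {m X : Type} [DecidableEq m] {r : ℕ} (e : X ≃ m × Fin r) (c : Finset (Fin r))
    (U : Matrix m m ℂ) : Matrix X X ℂ :=
  (controlled c U).submatrix e e

theorem onReg_one {m X : Type} [DecidableEq m] [DecidableEq X] {r : ℕ} (e : X ≃ m × Fin r)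
    (c : Finset (Fin r)) : onReg e c (1 : Matrix m m ℂ) = 1 := by
  have h : (fun _ : Fin r => (1 : Matrix m m ℂ)) = 1 := rfl
  simp [onReg, controlled, h]

theorem onReg_mul {m X : Type} [Fintype m] [DecidableEq m] [Fintype X] {r : ℕ}
    (e : X ≃ m × Fin r) (c : Finset (Fin r)) (U V : Matrix m m ℂ) :
    onReg e c (U * V) = onReg e c U * onReg e c V := by
  unfold onReg controlled
  rw [Matrix.submatrix_mul_equiv, ← Matrix.blockDiagonal_mul]
  congr 2
  funext j
  by_cases h : j ∈ c <;> simp [h]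

theorem onReg_conjTranspose {m X : Type} [DecidableEq m] {r : ℕ}
    (e : X ≃ m × Fin r) (c : Finset (Fin r)) (U : Matrix m m ℂ) :
    (onReg e c U)ᴴ = onReg e c Uᴴ := by
  unfold onReg controlled
  rw [Matrix.conjTranspose_submatrix, Matrix.blockDiagonal_conjTranspose]
  congr 2
  funext j
  by_cases h : j ∈ c <;> simp [h]

theorem onReg_unitary {m X : Type} [Fintype m] [DecidableEq m] [Fintype X] [DecidableEq X] {r : ℕ}
    (e : X ≃ m × Fin r) (c : Finset (Fin r)) {U : Matrix m m ℂ}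
    (hU : U ∈ Matrix.unitaryGroup m ℂ) : onReg e c U ∈ Matrix.unitaryGroup X ℂ := by
  rw [Matrix.mem_unitaryGroup_iff, Matrix.star_eq_conjTranspose] at hU ⊢
  rw [onReg_conjTranspose, ← onReg_mul, hU, onReg_one]

/-- Gates on `X` with queries to a first oracle on register `m` and a second one on register `n`.
In a query, `inv = true` stands for the inverse oracle and `c` lists the control values. -/
inductive Gate (m n X : Type) [Fintype X] [DecidableEq X] : Type
  | fixed (V : Matrix X X ℂ) (hV : V ∈ Matrix.unitaryGroup X ℂ) : Gate m n X
  | query₁ (inv : Bool) (r : ℕ) (e : X ≃ m × Fin r) (c : Finset (Fin r)) : Gate m n X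
  | query₂ (inv : Bool) (r : ℕ) (e : X ≃ n × Fin r) (c : Finset (Fin r)) : Gate m n X

/-- A circuit is a list of gates; the head of the list is applied first. -/
abbrev Circuit (m n X : Type) [Fintype X] [DecidableEq X] : Type := List (Gate m n X)

/-- The unitary `U` or its inverse. -/
def dirOp {m : Type} (inv : Bool) (U : Matrix m m ℂ) : Matrix m m ℂ := if inv then Uᴴ else U

/-- The operator that a gate performs when the two oracles are `U₁` and `U₂`. -/
def Gate.op {m n X : Type} [DecidableEq m] [DecidableEq n] [Fintype X] [DecidableEq X]
    (U₁ : Matrix m m ℂ) (U₂ : Matrix n n ℂ) : Gate m n X → Matrix X X ℂ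
  | .fixed V _ => V
  | .query₁ inv _ e c => onReg e c (dirOp inv U₁)
  | .query₂ inv _ e c => onReg e c (dirOp inv U₂)

/-- The operator that a circuit performs when the two oracles are `U₁` and `U₂`. -/
def Circuit.op {m n X : Type} [DecidableEq m] [DecidableEq n] [Fintype X] [DecidableEq X]
    (U₁ : Matrix m m ℂ) (U₂ : Matrix n n ℂ) : Circuit m n X → Matrix X X ℂ
  | [] => 1
  | g :: L => Circuit.op U₁ U₂ L * g.op U₁ U₂

/-- The number of queries of a circuit to the first oracle, its inverse, and controlled versions. -/
def Circuit.queries₁ {m n X : Type} [Fintype X] [DecidableEq X] : Circuit m n X → ℕ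
  | [] => 0
  | .query₁ _ _ _ _ :: L => Circuit.queries₁ L + 1
  | _ :: L => Circuit.queries₁ L

/-- The number of queries of a circuit to the second oracle, its inverse, and controlled
versions. -/
def Circuit.queries₂ {m n X : Type} [Fintype X] [DecidableEq X] : Circuit m n X → ℕ
  | [] => 0
  | .query₂ _ _ _ _ :: L => Circuit.queries₂ L + 1
  | _ :: L => Circuit.queries₂ L

/-- The inverse gate. -/
def Gate.inverse {m n X : Type} [Fintype X] [DecidableEq X] : Gate m n X → Gate m n X
  | .fixed V hV => .fixed (star V) (Unitary.star_mem hV)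
  | .query₁ inv r e c => .query₁ (!inv) r e c
  | .query₂ inv r e c => .query₂ (!inv) r e c

/-- The inverse circuit. -/
def Circuit.inverse {m n X : Type} [Fintype X] [DecidableEq X] (C : Circuit m n X) :
    Circuit m n X :=
  (C.map Gate.inverse).reverse

/-- If `Y ≅ k × Fin r'` and `X ≅ Y × Fin r`, then `X ≅ k × Fin (r' * r)`. -/
def nestReg {k Y X : Type} {r r' : ℕ} (e : X ≃ Y × Fin r) (e' : Y ≃ k × Fin r') :
    X ≃ k × Fin (r' * r) :=
  (e.trans (e'.prodCongr (Equiv.refl _))).trans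
    ((Equiv.prodAssoc _ _ _).trans ((Equiv.refl _).prodCongr finProdFinEquiv))

/-- The joint control values of a controlled operation inside a controlled operation. -/
def nestCtrl {r r' : ℕ} (c : Finset (Fin r)) (c' : Finset (Fin r')) : Finset (Fin (r' * r)) :=
  (c' ×ˢ c).map finProdFinEquiv.toEmbedding

/-- A gate on `Y`, performed on the factor `Y` of `X ≅ Y × Fin r` with additional control `c`. -/
def Gate.lift {m n Y X : Type} [Fintype Y] [DecidableEq Y] [Fintype X] [DecidableEq X] {r : ℕ}
    (e : X ≃ Y × Fin r) (c : Finset (Fin r)) : Gate m n Y → Gate m n X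
  | .fixed V hV => .fixed (onReg e c V) (onReg_unitary e c hV)
  | .query₁ inv r' e' c' => .query₁ inv (r' * r) (nestReg e e') (nestCtrl c c')
  | .query₂ inv r' e' c' => .query₂ inv (r' * r) (nestReg e e') (nestCtrl c c')

/-- Substitution: every query of `C` to its first oracle (on `Y`) is replaced by the circuit `P`
(or by its inverse), which is itself a circuit with queries. The second oracle is shared. -/
def Circuit.subst {m n Y X : Type} [Fintype Y] [DecidableEq Y] [Fintype X] [DecidableEq X]
    (P : Circuit m n Y) : Circuit Y n X → Circuit m n X
  | [] => []
  | .fixed V hV :: L => .fixed V hV :: Circuit.subst P L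
  | .query₁ inv _ e c :: L =>
      ((if inv then P.inverse else P).map (Gate.lift e c)) ++ Circuit.subst P L
  | .query₂ inv r e c :: L => .query₂ inv r e c :: Circuit.subst P L

/-! ### Quantum singular value transformation -/

/-- `exp (i φ (2 Π - I))` for the projection `Π = G G†`. -/
def phaseOp {m n : Type} [Fintype n] [DecidableEq m] (G : Matrix m n ℂ) (φ : ℝ) : Matrix m m ℂ :=
  Complex.exp (φ * Complex.I) • (G * Gᴴ) + Complex.exp (-(φ * Complex.I)) • (1 - G * Gᴴ)

/-- `|0⟩⟨0| ⊗ exp (i φ (2 Π - I)) + |1⟩⟨1| ⊗ exp (-i φ (2 Π - I))`, with the qubit as the second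
factor. -/
def ctrlPhase {m n : Type} [Fintype n] [DecidableEq m] (G : Matrix m n ℂ) (φ : ℝ) :
    Matrix (m × Fin 2) (m × Fin 2) ℂ :=
  blockDiagonal fun j : Fin 2 => phaseOp G (if j = 0 then φ else -φ)

theorem phaseOp_mul {m n : Type} [Fintype m] [Fintype n] [DecidableEq m] [DecidableEq n]
    {G : Matrix m n ℂ} (hG : IsIso G) (φ : ℝ) : phaseOp G φ * (phaseOp G φ)ᴴ = 1 := by
  have hP : (G * Gᴴ) * (G * Gᴴ) = G * Gᴴ := by
    rw [Matrix.mul_assoc, ← Matrix.mul_assoc Gᴴ, show Gᴴ * G = 1 from hG, Matrix.one_mul]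
  have h1 : Complex.exp (φ * Complex.I) * star (Complex.exp (φ * Complex.I)) = 1 := by
    rw [Complex.star_def, ← Complex.exp_conj, ← Complex.exp_add]
    simp
  have h2 : Complex.exp (-(φ * Complex.I)) * star (Complex.exp (-(φ * Complex.I))) = 1 := by
    rw [Complex.star_def, ← Complex.exp_conj, ← Complex.exp_add]
    simp
  have hH : (G * Gᴴ)ᴴ = G * Gᴴ := by simp
  unfold phaseOp
  generalize G * Gᴴ = Q at hP hH ⊢
  rw [Matrix.conjTranspose_add, Matrix.conjTranspose_smul, Matrix.conjTranspose_smul,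
    Matrix.conjTranspose_sub, Matrix.conjTranspose_one, hH]
  simp only [add_mul, mul_add, smul_mul_smul_comm, mul_sub, sub_mul, hP, h1, h2, Matrix.one_mul,
    Matrix.mul_one]
  simp

theorem ctrlPhase_unitary {m n : Type} [Fintype m] [Fintype n] [DecidableEq m] [DecidableEq n]
    {G : Matrix m n ℂ} (hG : IsIso G) (φ : ℝ) :
    ctrlPhase G φ ∈ Matrix.unitaryGroup (m × Fin 2) ℂ := by
  rw [Matrix.mem_unitaryGroup_iff, Matrix.star_eq_conjTranspose, ctrlPhase,
    Matrix.blockDiagonal_conjTranspose, ← Matrix.blockDiagonal_mul]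
  have h : (fun k : Fin 2 => phaseOp G (if k = 0 then φ else -φ) *
      (phaseOp G (if k = 0 then φ else -φ))ᴴ) = 1 := by
    funext k
    exact phaseOp_mul hG _
  rw [h, Matrix.blockDiagonal_one]

/-- The quantum singular value transformation sequence with phases `Φ`: queries to `U†` and `U`
alternate (the first one is to `U†` if `inv = true`), and each is followed by a phase operator,
whose sign is controlled by one qubit. It makes `Φ.length` queries to `U`, which is the first
oracle, and none to the second oracle. -/
def qsvt {m n k : Type} [Fintype m] [Fintype n] [DecidableEq m] [DecidableEq n]
    {G : Matrix m n ℂ} (hG : IsIso G) : Bool → List ℝ → Circuit m k (m × Fin 2)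
  | _, [] => []
  | inv, φ :: Φ =>
      .query₁ inv 2 (Equiv.refl _) Finset.univ ::
        .fixed (ctrlPhase G φ) (ctrlPhase_unitary hG φ) :: qsvt hG (!inv) Φ

/-- The isometry `G ⊗ |+⟩`. -/
def plusIso {m n : Type} (G : Matrix m n ℂ) : Matrix (m × Fin 2) n ℂ :=
  fun x i => ((Real.sqrt 2 : ℝ) : ℂ)⁻¹ * G x.1 i

/-- `U` block encodes `B` with accuracy `δ`, relative to the isometry `G`. -/
def ApproxBlockEncodes {m n : Type} [Fintype m] [DecidableEq m] [Fintype n] [DecidableEq n]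
    (G : Matrix m n ℂ) (U : Matrix m m ℂ) (B : Matrix n n ℂ) (δ : ℝ) : Prop :=
  IsIso G ∧ U ∈ Matrix.unitaryGroup m ℂ ∧ ‖Gᴴ * U * G - B‖ ≤ δ

/-! ### State preparation -/

/-- The state `V |0⟩|0⟩` of a system of dimension `d` and a workspace of dimension `w + 1`,
projected onto the workspace state `|0⟩` (unnormalized). -/
def flaggedState {d w : ℕ} [NeZero d]
    (V : Matrix (Fin d × Fin (w + 1)) (Fin d × Fin (w + 1)) ℂ) : Fin d → ℂ :=
  fun i => (V *ᵥ Pi.single (0, 0) 1) (i, 0)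

/-- `V`, applied to `|0⟩|0⟩`, prepares the state `x` to accuracy `ε` with success probability
more than `p`: a measurement of the workspace gives the outcome `|0⟩` with probability more than
`p`, and the normalized state of the system after this outcome is within Euclidean distance `ε`
of `x`. -/
def Prepares {d w : ℕ} [NeZero d]
    (V : Matrix (Fin d × Fin (w + 1)) (Fin d × Fin (w + 1)) ℂ) (x : Fin d → ℂ) (ε p : ℝ) : Prop :=
  p < norm2 (flaggedState V) ^ 2 ∧ norm2 (unitVec (flaggedState V) - x) ≤ ε

end

end QLS

set_option linter.unusedSectionVars false

/-! Write `x = A⁻¹ b`. Without preconditioning, a block encoding of `A⁻¹` maps `b` to a vector whose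
norm can be of order `1 / κ`, and amplifying it costs a further factor. The scaling `S` shrinks the
direction `b` by `s`, so `(SA)⁻¹ = A⁻¹ S⁻¹` stretches the solution by `1 / s` and leaves its
direction alone. Since `s` is comparable to `‖x‖ / αinv`, the stretched solution has norm at least
`αinv`. The norm of `(SA)⁻¹` still grows only by the constant `γ = √(c⁴ + 1)`: as `S⁻²` is diagonal
with respect to `b` and its complement, `(SA)⁻¹ ((SA)⁻¹)ᴴ` is a sum of two terms of norm at most `c⁴
αinv²` and `αinv²` (`norm_mul_scaling_le`). The encoded inverse thus produces an amplitude of at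
least `1 / (2 γ)`, up to the error of the encoding, and a number of amplification rounds depending
only on `c` suffices.

The inverse comes from a polynomial `x a(x²)` of degree `O(κ log (1 / ε))`, bounded by `1` and close
to `1 / (2 κ x)` (`exists_inverse_polynomial`). It is built from a Fejér kernel `F(x²)`, equal to
`1` at `0` and below `1 / 2` for `x ≥ 1 / κ`, which a majority vote sharpens to a function that is
`0` at `0` and nearly `1` away from it; division by `2 κ x` is then exact.

Such a polynomial has phases (`exists_phases`): by the theorem of Markov and Lukács it is the real
part of a polynomial that satisfies the normalization identity of quantum signal processing, and
phases are peeled off one degree at a time. The passage to matrices (`exists_qsvt`) uses the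
Hermitian dilation of `U`, which turns singular values into eigenvalues.

Amplitude amplification is the same transformation applied to a rank-one matrix `v ⟨0|`, with an odd
polynomial near `1` on `[1 / (4 γ), 1]` (`exists_amplification_circuit`, `exists_sign_polynomial`).
-/

namespace QLS

/-! ### Semantics and query counts of circuits and of substitution -/

section Circuits

variable {m n X Y : Type} [DecidableEq m] [DecidableEq n] [Fintype X] [DecidableEq X]
  [Fintype Y] [DecidableEq Y]

theorem dirOp_not (inv : Bool) (U : Matrix m m ℂ) : dirOp (!inv) U = (dirOp inv U)ᴴ := by
  cases inv <;> simp [dirOp]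

theorem dirOp_unitary [Fintype m] (inv : Bool) {U : Matrix m m ℂ}
    (hU : U ∈ Matrix.unitaryGroup m ℂ) : dirOp inv U ∈ Matrix.unitaryGroup m ℂ := by
  cases inv
  · exact hU
  · exact Unitary.star_mem hU

theorem Circuit.op_append (U₁ : Matrix m m ℂ) (U₂ : Matrix n n ℂ) (C C' : Circuit m n X) :
    Circuit.op U₁ U₂ (C ++ C') = Circuit.op U₁ U₂ C' * Circuit.op U₁ U₂ C := by
  induction C with
  | nil => simp [Circuit.op]
  | cons g L ih => simp [Circuit.op, ih, Matrix.mul_assoc]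

theorem Gate.op_inverse (U₁ : Matrix m m ℂ) (U₂ : Matrix n n ℂ) (g : Gate m n X) :
    g.inverse.op U₁ U₂ = (g.op U₁ U₂)ᴴ := by
  cases g <;> simp [Gate.inverse, Gate.op, dirOp_not, onReg_conjTranspose, star_eq_conjTranspose]

theorem Circuit.op_inverse (U₁ : Matrix m m ℂ) (U₂ : Matrix n n ℂ) (C : Circuit m n X) :
    Circuit.op U₁ U₂ C.inverse = (Circuit.op U₁ U₂ C)ᴴ := by
  induction C with
  | nil => simp [Circuit.inverse, Circuit.op]
  | cons g L ih =>
    have : Circuit.inverse (g :: L) = Circuit.inverse L ++ [g.inverse] := by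
      simp [Circuit.inverse]
    rw [this, Circuit.op_append, ih]
    simp [Circuit.op, Gate.op_inverse]

theorem Circuit.op_unitary [Fintype m] [Fintype n] {U₁ : Matrix m m ℂ} {U₂ : Matrix n n ℂ}
    (h₁ : U₁ ∈ Matrix.unitaryGroup m ℂ) (h₂ : U₂ ∈ Matrix.unitaryGroup n ℂ)
    (C : Circuit m n X) : Circuit.op U₁ U₂ C ∈ Matrix.unitaryGroup X ℂ := by
  induction C with
  | nil => exact one_mem _
  | cons g L ih =>
    refine mul_mem ih ?_
    cases g with
    | fixed V hV => exact hV
    | query₁ inv r e c => exact onReg_unitary e c (dirOp_unitary inv h₁)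
    | query₂ inv r e c => exact onReg_unitary e c (dirOp_unitary inv h₂)

/-- A control inside a control is active exactly on the product of the two control sets. A
substituted circuit therefore consists again of ordinary controlled queries. -/
theorem onReg_nest {k : Type} [DecidableEq k] {r r' : ℕ} (e : X ≃ Y × Fin r)
    (c : Finset (Fin r)) (e' : Y ≃ k × Fin r') (c' : Finset (Fin r')) (U : Matrix k k ℂ) :
    onReg (nestReg e e') (nestCtrl c c') U = onReg e c (onReg e' c' U) := by
  ext x x'
  have h1 : ∀ z : X, nestReg e e' z =
      ((e' (e z).1).1, finProdFinEquiv ((e' (e z).1).2, (e z).2)) := fun z => rfl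
  have h2 : ∀ p : Fin r' × Fin r, finProdFinEquiv p ∈ nestCtrl c c' ↔ p.1 ∈ c' ∧ p.2 ∈ c := by
    intro p
    simp [nestCtrl]
  simp only [onReg, controlled, Matrix.submatrix_apply, h1]
  generalize e x = z
  generalize e x' = z'
  obtain ⟨z, j⟩ := z
  obtain ⟨z', j'⟩ := z'
  obtain ⟨⟨a, b⟩, rfl⟩ := e'.symm.surjective z
  obtain ⟨⟨a', b'⟩, rfl⟩ := e'.symm.surjective z'
  simp only [Equiv.apply_symm_apply, Matrix.blockDiagonal_apply', h2,
    EmbeddingLike.apply_eq_iff_eq, Prod.mk.injEq]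
  by_cases hj : j = j' <;> by_cases hc : j ∈ c <;> by_cases hb : b = b' <;>
    by_cases hc' : b ∈ c' <;>
    simp_all [Matrix.one_apply, Matrix.blockDiagonal_apply']

theorem Gate.op_lift (U₁ : Matrix m m ℂ) (U₂ : Matrix n n ℂ) {r : ℕ} (e : X ≃ Y × Fin r)
    (c : Finset (Fin r)) (g : Gate m n Y) :
    (g.lift e c).op U₁ U₂ = onReg e c (g.op U₁ U₂) := by
  cases g <;> simp [Gate.lift, Gate.op, onReg_nest]

theorem Circuit.op_lift (U₁ : Matrix m m ℂ) (U₂ : Matrix n n ℂ) {r : ℕ} (e : X ≃ Y × Fin r)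
    (c : Finset (Fin r)) (C : Circuit m n Y) :
    Circuit.op U₁ U₂ (C.map (Gate.lift e c)) = onReg e c (Circuit.op U₁ U₂ C) := by
  induction C with
  | nil => simp [Circuit.op, onReg_one]
  | cons g L ih => simp [Circuit.op, ih, Gate.op_lift, onReg_mul]

/-- Inverting a circuit and adding a control to it both commute with evaluation. Each stage of the
algorithm can thus treat the preceding one as a black-box unitary. -/
theorem Circuit.op_subst (U₁ : Matrix m m ℂ) (U₂ : Matrix n n ℂ) (P : Circuit m n Y)
    (C : Circuit Y n X) :
    Circuit.op U₁ U₂ (Circuit.subst P C) = Circuit.op (Circuit.op U₁ U₂ P) U₂ C := by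
  induction C with
  | nil => rfl
  | cons g L ih =>
    cases g with
    | fixed V hV => simp [Circuit.subst, Circuit.op, Gate.op, ih]
    | query₁ inv r e c =>
      rw [Circuit.subst, Circuit.op_append, Circuit.op_lift, Circuit.op, ih]
      cases inv <;> simp [Gate.op, dirOp, Circuit.op_inverse]
    | query₂ inv r e c => simp [Circuit.subst, Circuit.op, Gate.op, ih]

theorem Circuit.queries₁_append (C C' : Circuit m n X) :
    Circuit.queries₁ (C ++ C') = Circuit.queries₁ C + Circuit.queries₁ C' := by
  induction C with
  | nil => simp [Circuit.queries₁]
  | cons g L ih => cases g <;> simp [Circuit.queries₁, ih]; omega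

theorem Circuit.queries₂_append (C C' : Circuit m n X) :
    Circuit.queries₂ (C ++ C') = Circuit.queries₂ C + Circuit.queries₂ C' := by
  induction C with
  | nil => simp [Circuit.queries₂]
  | cons g L ih => cases g <;> simp [Circuit.queries₂, ih]; omega

theorem Circuit.queries₁_inverse (C : Circuit m n X) :
    Circuit.queries₁ C.inverse = Circuit.queries₁ C := by
  induction C with
  | nil => rfl
  | cons g L ih =>
    have : Circuit.inverse (g :: L) = Circuit.inverse L ++ [g.inverse] := by
      simp [Circuit.inverse]
    rw [this, Circuit.queries₁_append, ih]
    cases g <;> simp [Circuit.queries₁, Gate.inverse]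

theorem Circuit.queries₂_inverse (C : Circuit m n X) :
    Circuit.queries₂ C.inverse = Circuit.queries₂ C := by
  induction C with
  | nil => rfl
  | cons g L ih =>
    have : Circuit.inverse (g :: L) = Circuit.inverse L ++ [g.inverse] := by
      simp [Circuit.inverse]
    rw [this, Circuit.queries₂_append, ih]
    cases g <;> simp [Circuit.queries₂, Gate.inverse]

theorem Circuit.queries₁_lift {r : ℕ} (e : X ≃ Y × Fin r) (c : Finset (Fin r))
    (C : Circuit m n Y) : Circuit.queries₁ (C.map (Gate.lift e c)) = Circuit.queries₁ C := by
  induction C with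
  | nil => rfl
  | cons g L ih => cases g <;> simpa [Circuit.queries₁, Gate.lift] using ih

theorem Circuit.queries₂_lift {r : ℕ} (e : X ≃ Y × Fin r) (c : Finset (Fin r))
    (C : Circuit m n Y) : Circuit.queries₂ (C.map (Gate.lift e c)) = Circuit.queries₂ C := by
  induction C with
  | nil => rfl
  | cons g L ih => cases g <;> simpa [Circuit.queries₂, Gate.lift] using ih

theorem Circuit.queries₁_subst (P : Circuit m n Y) (C : Circuit Y n X) :
    Circuit.queries₁ (Circuit.subst P C) = Circuit.queries₁ C * Circuit.queries₁ P := by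
  induction C with
  | nil => simp [Circuit.subst, Circuit.queries₁]
  | cons g L ih =>
    cases g with
    | fixed V hV => simpa [Circuit.subst, Circuit.queries₁] using ih
    | query₁ inv r e c =>
      rw [Circuit.subst, Circuit.queries₁_append, Circuit.queries₁_lift, ih]
      cases inv <;> simp [Circuit.queries₁, Circuit.queries₁_inverse] <;> ring
    | query₂ inv r e c => simpa [Circuit.subst, Circuit.queries₁] using ih

theorem Circuit.queries₂_subst (P : Circuit m n Y) (C : Circuit Y n X) :
    Circuit.queries₂ (Circuit.subst P C) =
      Circuit.queries₁ C * Circuit.queries₂ P + Circuit.queries₂ C := by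
  induction C with
  | nil => simp [Circuit.subst, Circuit.queries₁, Circuit.queries₂]
  | cons g L ih =>
    cases g with
    | fixed V hV => simpa [Circuit.subst, Circuit.queries₁, Circuit.queries₂] using ih
    | query₁ inv r e c =>
      rw [Circuit.subst, Circuit.queries₂_append, Circuit.queries₂_lift, ih]
      cases inv <;>
        simp [Circuit.queries₁, Circuit.queries₂, Circuit.queries₂_inverse] <;> ring
    | query₂ inv r e c => simp [Circuit.subst, Circuit.queries₁, Circuit.queries₂, ih]; ring

theorem queries₁_qsvt {G : Matrix m n ℂ} {k : Type} [Fintype m] [Fintype n] (hG : IsIso G)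
    (inv : Bool) (Φ : List ℝ) :
    Circuit.queries₁ (qsvt (k := k) hG inv Φ) = Φ.length := by
  induction Φ generalizing inv with
  | nil => rfl
  | cons φ Φ ih => simp [qsvt, Circuit.queries₁, ih]

theorem queries₂_qsvt {G : Matrix m n ℂ} {k : Type} [Fintype m] [Fintype n] (hG : IsIso G)
    (inv : Bool) (Φ : List ℝ) :
    Circuit.queries₂ (qsvt (k := k) hG inv Φ) = 0 := by
  induction Φ generalizing inv with
  | nil => rfl
  | cons φ Φ ih => simp [qsvt, Circuit.queries₂, ih]

end Circuits

/-! ### Phases of quantum signal processing -/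

section SignalProcessing

open Polynomial

/-- One step of quantum signal processing, on the pair of polynomials `(P, Q)` that stands for the
vector `(P(x), √(1 - x²) Q(x))`: the reflection `[[x, √(1 - x²)], [√(1 - x²), -x]]` followed by the
phases `u` and `v`. -/
noncomputable def qspStep (u v : ℂ) (p : ℂ[X] × ℂ[X]) : ℂ[X] × ℂ[X] :=
  (C u * (X * p.1 + (1 - X ^ 2) * p.2), C v * (p.1 - X * p.2))

/-- The pair of polynomials that is produced from `p` by quantum signal processing with the phases
`Φ`. -/
noncomputable def qspPair (p : ℂ[X] × ℂ[X]) (Φ : List ℝ) : ℂ[X] × ℂ[X] :=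
  Φ.foldl (fun q (φ : ℝ) =>
    qspStep (Complex.exp (φ * Complex.I)) (Complex.exp (-(φ * Complex.I))) q) p

/-- The polynomial with complex conjugate coefficients. -/
noncomputable abbrev conjPoly (P : ℂ[X]) : ℂ[X] := P.map (starRingEnd ℂ)

theorem exp_conj_phase (φ : ℝ) :
    (starRingEnd ℂ) (Complex.exp (φ * Complex.I)) = Complex.exp (-(φ * Complex.I)) := by
  rw [← Complex.exp_conj]; simp

theorem exp_phase_mul (φ : ℝ) :
    Complex.exp (φ * Complex.I) * Complex.exp (-(φ * Complex.I)) = 1 := by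
  rw [← Complex.exp_add]; simp

/-- The reflection has real coefficients and conjugation inverts every phase. Combining the runs
with `Φ` and `-Φ` therefore extracts the real part of a polynomial. -/
theorem qspPair_neg (p : ℂ[X] × ℂ[X]) (Φ : List ℝ) :
    qspPair (conjPoly p.1, conjPoly p.2) (Φ.map fun φ => -φ) =
      (conjPoly (qspPair p Φ).1, conjPoly (qspPair p Φ).2) := by
  induction Φ generalizing p with
  | nil => rfl
  | cons φ Φ ih =>
    simp only [qspPair, List.map_cons, List.foldl_cons] at ih ⊢
    rw [← ih]
    congr 1
    have h := exp_conj_phase φ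
    have h' := exp_conj_phase (-φ)
    push_cast at h'
    simp only [neg_mul, neg_neg] at h'
    simp [qspStep, conjPoly, h, h']

/-- Existence of a phase that balances two numbers of equal modulus. -/
theorem exists_phase_eq {p q : ℂ} (h : p * (starRingEnd ℂ) p = q * (starRingEnd ℂ) q) :
    ∃ φ : ℝ, Complex.exp (-(φ * Complex.I)) * p = Complex.exp (φ * Complex.I) * q := by
  have hn : ‖p‖ = ‖q‖ := by
    rw [Complex.mul_conj, Complex.mul_conj] at h
    have h' : Complex.normSq p = Complex.normSq q := by exact_mod_cast h
    rw [Complex.normSq_eq_norm_sq, Complex.normSq_eq_norm_sq] at h'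
    exact (sq_eq_sq₀ (norm_nonneg _) (norm_nonneg _)).1 h'
  refine ⟨(Complex.arg p - Complex.arg q) / 2, ?_⟩
  have hp := Complex.norm_mul_exp_arg_mul_I p
  have hq := Complex.norm_mul_exp_arg_mul_I q
  generalize p.arg = α at hp ⊢
  generalize q.arg = β at hq ⊢
  rw [← hp, ← hq, hn, mul_left_comm, mul_left_comm _ (‖q‖ : ℂ),
    ← Complex.exp_add, ← Complex.exp_add]
  congr 2
  push_cast
  ring

/-- Phases for a normalized pair of polynomials of definite parity. -/
theorem exists_qspPair_eq (n : ℕ) (P Q : ℂ[X])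
    (hP : ∀ k, P.coeff k ≠ 0 → k ≤ n ∧ Even (n + k))
    (hQ : ∀ k, Q.coeff k ≠ 0 → k + 1 ≤ n ∧ Odd (n + k))
    (h : P * conjPoly P + (1 - X ^ 2) * (Q * conjPoly Q) = 1) :
    ∃ (Φ : List ℝ) (u : ℂ), Φ.length = n ∧ u * (starRingEnd ℂ) u = 1 ∧
      qspPair (C u, 0) Φ = (P, Q) := by
  induction n generalizing P Q with
  | zero =>
    have hQ0 : Q = 0 := by
      ext k
      by_contra hk
      have := (hQ k hk).1
      omega
    have hP0 : P = C (P.coeff 0) := by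
      ext k
      rcases k with _ | k
      · simp
      · rw [coeff_C_succ]
        by_contra hk
        have := (hP _ hk).1
        omega
    refine ⟨[], P.coeff 0, rfl, ?_, ?_⟩
    · rw [hQ0, hP0] at h
      simp only [conjPoly, map_C, ← C_mul, zero_mul, mul_zero, add_zero] at h
      rw [← C_1] at h
      simpa using C_injective h
    · rw [hQ0, ← hP0]; rfl
  | succ n ih =>
    have hPd : ∀ k, n + 1 < k → P.coeff k = 0 := fun k hk => by
      by_contra hc; have := (hP k hc).1; omega
    have hQd : ∀ k, n < k → Q.coeff k = 0 := fun k hk => by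
      by_contra hc; have := (hQ k hc).1; omega
    have hPe : ∀ k, Odd (n + 1 + k) → P.coeff k = 0 := fun k hk => by
      by_contra hc; exact (Nat.not_even_iff_odd.2 hk) (hP k hc).2
    have hQe : ∀ k, Even (n + 1 + k) → Q.coeff k = 0 := fun k hk => by
      by_contra hc; exact (Nat.not_odd_iff_even.2 hk) (hQ k hc).2
    have hPn : P.natDegree ≤ n + 1 := natDegree_le_iff_coeff_eq_zero.2 hPd
    have hQn : Q.natDegree ≤ n := natDegree_le_iff_coeff_eq_zero.2 hQd
    have hPn' : (conjPoly P).natDegree ≤ n + 1 := natDegree_map_le.trans hPn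
    have hQn' : (conjPoly Q).natDegree ≤ n := natDegree_map_le.trans hQn
    -- The coefficient of `X ^ (2 * n + 2)` in the normalization identity is the difference of the
    -- two sides, so the leading coefficients have equal modulus and one phase can align them.
    have hlead : P.coeff (n + 1) * (starRingEnd ℂ) (P.coeff (n + 1)) =
        Q.coeff n * (starRingEnd ℂ) (Q.coeff n) := by
      have h1 := congrArg (fun R : ℂ[X] => R.coeff (n + 1 + (n + 1))) h
      have e1 : (P * conjPoly P).coeff (n + 1 + (n + 1)) =
          P.coeff (n + 1) * (starRingEnd ℂ) (P.coeff (n + 1)) := by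
        rw [coeff_mul_add_eq_of_natDegree_le hPn hPn', coeff_map]
      have e2 : (Q * conjPoly Q).coeff (n + n) = Q.coeff n * (starRingEnd ℂ) (Q.coeff n) := by
        rw [coeff_mul_add_eq_of_natDegree_le hQn hQn', coeff_map]
      have e3 : (Q * conjPoly Q).coeff (n + n + 2) = 0 := by
        apply coeff_eq_zero_of_natDegree_lt
        exact (natDegree_mul_le.trans (add_le_add hQn hQn')).trans_lt (by omega)
      simp only [coeff_add, e1, sub_mul, one_mul, coeff_sub] at h1
      rw [show n + 1 + (n + 1) = n + n + 2 by ring, e3, coeff_X_pow_mul, e2, coeff_one] at h1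
      simp at h1
      linear_combination h1
    obtain ⟨φ, hφ⟩ := exists_phase_eq hlead
    set u := Complex.exp (φ * Complex.I) with hu
    set v := Complex.exp (-(φ * Complex.I)) with hv
    have huv : u * v = 1 := exp_phase_mul φ
    have hcu : (starRingEnd ℂ) u = v := exp_conj_phase φ
    have hcv : (starRingEnd ℂ) v = u := by rw [← hcu, Complex.conj_conj]
    have hCuv : (C u * C v : ℂ[X]) = 1 := by rw [← C_mul, huv, C_1]
    -- The reflection is an involution, so the last step is undone by removing the phases and
    -- reflecting again. The choice of `φ` cancels the top coefficient of both results.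
    set P' : ℂ[X] := X * (C v * P) + (1 - X ^ 2) * (C u * Q) with hP'
    set Q' : ℂ[X] := C v * P - X * (C u * Q) with hQ'
    have cP' : ∀ k, P'.coeff k = (if k = 0 then 0 else v * P.coeff (k - 1)) + u * Q.coeff k
        - (if k < 2 then 0 else u * Q.coeff (k - 2)) := by
      intro k
      rw [hP', coeff_add, sub_mul, one_mul, coeff_sub, coeff_C_mul, coeff_X_pow_mul', ]
      rcases k with _ | k
      · simp
      · rw [coeff_X_mul, coeff_C_mul]
        by_cases h2 : 2 ≤ k + 1
        · simp [h2, not_lt.2 h2, coeff_C_mul]; ring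
        · simp [h2, not_le.1 h2]
    have cQ' : ∀ k, Q'.coeff k = v * P.coeff k - (if k = 0 then 0 else u * Q.coeff (k - 1)) := by
      intro k
      rw [hQ', coeff_sub, coeff_C_mul]
      rcases k with _ | k
      · simp
      · rw [coeff_X_mul, coeff_C_mul]; simp
    obtain ⟨Φ, w, hlen, hw, hpair⟩ := ih P' Q' (by
        intro k hk
        have hpar : Even (n + k) := by
          by_contra hne
          rw [Nat.not_even_iff_odd] at hne
          apply hk
          rw [cP']
          rcases k with _ | _ | k
          · simp [hQe 0 (by obtain ⟨j, hj⟩ := hne; exact ⟨j + 1, by omega⟩)]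
          · simp [hQe 1 (by obtain ⟨j, hj⟩ := hne; exact ⟨j + 1, by omega⟩),
              hPe 0 (by obtain ⟨j, hj⟩ := hne; exact ⟨j, by omega⟩)]
          · simp [hQe (k + 2) (by obtain ⟨j, hj⟩ := hne; exact ⟨j + 1, by omega⟩),
              hQe k (by obtain ⟨j, hj⟩ := hne; exact ⟨j, by omega⟩),
              hPe (k + 1) (by obtain ⟨j, hj⟩ := hne; exact ⟨j, by omega⟩)]
        refine ⟨?_, hpar⟩
        by_contra hlt
        apply hk
        rw [cP']
        -- The formal degree of `P'` is `n + 2`. The coefficient there vanishes by the choice of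
        -- `φ`, and parity excludes `n + 1`, which brings the degree down to `n`.
        have hk1 : k ≠ n + 1 := by
          rintro rfl
          obtain ⟨j, hj⟩ := hpar
          omega
        obtain ⟨j, rfl⟩ : ∃ j, k = n + 2 + j := ⟨k - (n + 2), by omega⟩
        rw [if_neg (by omega), if_neg (by omega), hQd (n + 2 + j) (by omega),
          show n + 2 + j - 1 = n + 1 + j by omega, show n + 2 + j - 2 = n + j by omega]
        rcases j with _ | j
        · simp [hφ]
        · rw [hPd _ (by omega), hQd _ (by omega)]; simp)
      (by
        intro k hk
        have hpar : Odd (n + k) := by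
          by_contra hne
          rw [Nat.not_odd_iff_even] at hne
          apply hk
          rw [cQ', hPe k (by obtain ⟨j, hj⟩ := hne; exact ⟨j, by omega⟩)]
          rcases k with _ | k
          · simp
          · simp [hQe k (by obtain ⟨j, hj⟩ := hne; exact ⟨j, by omega⟩)]
        refine ⟨?_, hpar⟩
        by_contra hlt
        apply hk
        rw [cQ']
        have hk1 : k ≠ n := by
          rintro rfl
          obtain ⟨j, hj⟩ := hpar
          omega
        obtain ⟨j, rfl⟩ : ∃ j, k = n + 1 + j := ⟨k - (n + 1), by omega⟩
        rw [if_neg (by omega), show n + 1 + j - 1 = n + j by omega]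
        rcases j with _ | j
        · simp [hφ]
        · rw [hPd _ (by omega), hQd _ (by omega)]; simp)
      (by
        simp only [hP', hQ', conjPoly, Polynomial.map_add, Polynomial.map_mul,
          Polynomial.map_sub, Polynomial.map_one, Polynomial.map_pow, map_X, map_C, hcu, hcv]
        simp only [conjPoly] at h
        linear_combination h + (P * map (starRingEnd ℂ) P +
          (1 - X ^ 2) * (Q * map (starRingEnd ℂ) Q)) * hCuv)
    refine ⟨Φ ++ [φ], w, by simp [hlen], hw, ?_⟩
    rw [qspPair, List.foldl_append]
    change qspStep u v (qspPair (C w, 0) Φ) = _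
    rw [hpair, qspStep]
    refine Prod.ext ?_ ?_
    · simp only [hP', hQ']
      linear_combination P * hCuv
    · simp only [hP', hQ']
      linear_combination Q * hCuv

theorem qspPair_C_mul (u : ℂ) (p : ℂ[X] × ℂ[X]) (Φ : List ℝ) :
    qspPair (C u * p.1, C u * p.2) Φ = (C u * (qspPair p Φ).1, C u * (qspPair p Φ).2) := by
  induction Φ generalizing p with
  | nil => rfl
  | cons φ Φ ih =>
    simp only [qspPair, List.foldl_cons] at ih ⊢
    rw [← ih]
    congr 1
    simp only [qspStep]
    refine Prod.ext ?_ ?_ <;> simp only <;> ring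

/-- Phases for the first component of a normalized pair, with the trivial start `(1, 0)`. -/
theorem exists_qspPair_fst_eq (n : ℕ) (P Q : ℂ[X])
    (hP : ∀ k, P.coeff k ≠ 0 → k ≤ n + 1 ∧ Even (n + 1 + k))
    (hQ : ∀ k, Q.coeff k ≠ 0 → k + 1 ≤ n + 1 ∧ Odd (n + 1 + k))
    (h : P * conjPoly P + (1 - X ^ 2) * (Q * conjPoly Q) = 1) :
    ∃ Φ : List ℝ, Φ.length = n + 1 ∧ (qspPair (1, 0) Φ).1 = P := by
  obtain ⟨Φ, u, hlen, hu, hpair⟩ := exists_qspPair_eq (n + 1) P Q hP hQ h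
  obtain ⟨Φ', φ, rfl⟩ : ∃ Φ' φ, Φ = Φ' ++ [φ] := by
    rcases List.eq_nil_or_concat Φ with rfl | ⟨L, b, rfl⟩
    · simp at hlen
    · exact ⟨L, b, by simp⟩
  have hu1 : u = Complex.exp (u.arg * Complex.I) := by
    have hn : ‖u‖ = 1 := by
      rw [Complex.mul_conj, Complex.normSq_eq_norm_sq] at hu
      have : ‖u‖ ^ 2 = 1 := by exact_mod_cast hu
      exact (pow_eq_one_iff_of_nonneg (norm_nonneg _) two_ne_zero).1 this
    have := Complex.norm_mul_exp_arg_mul_I u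
    rw [hn] at this
    simpa using this.symm
  -- The unimodular start factor commutes with every step and is absorbed into the last phase. This
  -- may spoil the second component, but only the first one is needed.
  refine ⟨Φ' ++ [φ + u.arg], by simpa using hlen, ?_⟩
  have h1 := congrArg Prod.fst hpair
  have h2 : ((C u, 0) : ℂ[X] × ℂ[X]) = (C u * 1, C u * 0) := by simp
  rw [h2, qspPair_C_mul u (1, 0)] at h1
  rw [← show C u * (qspPair (1, 0) (Φ' ++ [φ])).1 = P from h1]
  simp only [qspPair, List.foldl_append, List.foldl_cons, List.foldl_nil, qspStep]
  have h3 : Complex.exp (((φ + u.arg : ℝ) : ℂ) * Complex.I) =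
      u * Complex.exp (φ * Complex.I) := by
    conv_rhs => rw [hu1]
    rw [← Complex.exp_add]
    push_cast
    ring_nf
  rw [h3, C_mul]
  ring

end SignalProcessing

/-! ### Polynomials that are nonnegative on an interval -/

section Lukacs

open Polynomial

/-- The polynomials of degree at most `m` of the form `β² + x (1 - x) γ²` (for even `m`) or
`x β² + (1 - x) γ²` (for odd `m`), where `β` and `γ` have the appropriate degrees. -/
def IsLukacsForm (m : ℕ) (g : ℝ[X]) : Prop :=
  (∃ (k : ℕ) (β γ : ℝ[X]), m = 2 * k ∧ β.natDegree ≤ k ∧ (γ = 0 ∨ γ.natDegree + 1 ≤ k) ∧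
    g = β ^ 2 + X * (1 - X) * γ ^ 2) ∨
  (∃ (k : ℕ) (β γ : ℝ[X]), m = 2 * k + 1 ∧ β.natDegree ≤ k ∧ γ.natDegree ≤ k ∧
    g = X * β ^ 2 + (1 - X) * γ ^ 2)

theorem natDegree_one_sub_X_le : (1 - X : ℝ[X]).natDegree ≤ 1 :=
  (natDegree_sub_le _ _).trans (by simp)

theorem natDegree_mul_le_add {p q : ℝ[X]} {i j : ℕ} (hp : p.natDegree ≤ i)
    (hq : q.natDegree ≤ j) : (p * q).natDegree ≤ i + j :=
  natDegree_mul_le.trans (add_le_add hp hq)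

theorem natDegree_add_le_max {p q : ℝ[X]} {i : ℕ} (hp : p.natDegree ≤ i)
    (hq : q.natDegree ≤ i) : (p + q).natDegree ≤ i :=
  natDegree_add_le_of_degree_le hp hq

theorem natDegree_sub_le_max {p q : ℝ[X]} {i : ℕ} (hp : p.natDegree ≤ i)
    (hq : q.natDegree ≤ i) : (p - q).natDegree ≤ i :=
  natDegree_sub_le_of_le hp hq |>.trans (by simp)

theorem natDegree_mul_le_of_eq_zero_or {p q : ℝ[X]} {i j : ℕ}
    (hp : p = 0 ∨ p.natDegree + 1 ≤ i) (hq : q.natDegree ≤ j) :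
    p * q = 0 ∨ (p * q).natDegree + 1 ≤ i + j := by
  rcases hp with rfl | hp
  · simp
  · right
    have := natDegree_mul_le_add (i := i - 1) (p := p) (by omega) hq
    omega

theorem natDegree_linear_mul_le {p l : ℝ[X]} {i : ℕ} (hl : l.natDegree ≤ 1)
    (hp : p = 0 ∨ p.natDegree + 1 ≤ i) : (l * p).natDegree ≤ i := by
  rcases hp with rfl | hp
  · simp
  · have := natDegree_mul_le_add hl (le_refl p.natDegree)
    omega

theorem eq_zero_or_add {p q : ℝ[X]} {i : ℕ} (hp : p = 0 ∨ p.natDegree + 1 ≤ i)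
    (hq : q = 0 ∨ q.natDegree + 1 ≤ i) : p + q = 0 ∨ (p + q).natDegree + 1 ≤ i := by
  rcases hp with rfl | hp
  · simpa using hq
  · rcases hq with rfl | hq
    · right; simpa using hp
    · right
      have := natDegree_add_le_max (i := i - 1) (p := p) (q := q) (by omega) (by omega)
      omega

/-- On `(0, 1)` the two forms are `|β + i √(x (1 - x)) γ|²` and `|√x β + i √(1 - x) γ|²`.
Multiplying the complex numbers inside gives a number of one of these two shapes. -/
theorem IsLukacsForm.mul {m m' : ℕ} {g g' : ℝ[X]} (h : IsLukacsForm m g)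
    (h' : IsLukacsForm m' g') : IsLukacsForm (m + m') (g * g') := by
  have key : ∀ {j k : ℕ} {β₁ γ₁ β₂ γ₂ : ℝ[X]}, β₁.natDegree ≤ j →
      (γ₁ = 0 ∨ γ₁.natDegree + 1 ≤ j) → β₂.natDegree ≤ k → γ₂.natDegree ≤ k →
      IsLukacsForm (2 * j + (2 * k + 1))
        ((β₁ ^ 2 + X * (1 - X) * γ₁ ^ 2) * (X * β₂ ^ 2 + (1 - X) * γ₂ ^ 2)) := by
    intro j k β₁ γ₁ β₂ γ₂ h1 h2 h3 h4
    refine Or.inr ⟨j + k, β₁ * β₂ - (1 - X) * γ₁ * γ₂, β₁ * γ₂ + X * γ₁ * β₂, by ring, ?_, ?_,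
      by ring⟩
    · exact natDegree_sub_le_max (natDegree_mul_le_add h1 h3)
        (natDegree_mul_le_add (natDegree_linear_mul_le natDegree_one_sub_X_le h2) h4)
    · exact natDegree_add_le_max (natDegree_mul_le_add h1 h4)
        (natDegree_mul_le_add (natDegree_linear_mul_le natDegree_X_le h2) h3)
  rcases h with ⟨j, β₁, γ₁, rfl, h1, h2, rfl⟩ | ⟨j, β₁, γ₁, rfl, h1, h2, rfl⟩ <;>
    rcases h' with ⟨k, β₂, γ₂, rfl, h3, h4, rfl⟩ | ⟨k, β₂, γ₂, rfl, h3, h4, rfl⟩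
  · refine Or.inl ⟨j + k, β₁ * β₂ - (X * γ₁) * ((1 - X) * γ₂), γ₁ * β₂ + γ₂ * β₁,
      by ring, ?_, ?_, by ring⟩
    · exact natDegree_sub_le_max (natDegree_mul_le_add h1 h3)
        (natDegree_mul_le_add (natDegree_linear_mul_le natDegree_X_le h2)
          (natDegree_linear_mul_le natDegree_one_sub_X_le h4))
    · exact eq_zero_or_add (natDegree_mul_le_of_eq_zero_or h2 h3)
        (add_comm k j ▸ natDegree_mul_le_of_eq_zero_or h4 h1)
  · exact key h1 h2 h3 h4
  · rw [add_comm, mul_comm (X * β₁ ^ 2 + _)]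
    exact key h3 h4 h1 h2
  · refine Or.inl ⟨j + k + 1, X * (β₁ * β₂) - (1 - X) * (γ₁ * γ₂), β₁ * γ₂ + γ₁ * β₂,
      by ring, ?_, Or.inr ?_, by ring⟩
    · refine natDegree_sub_le_max ?_ ?_
      · exact (natDegree_mul_le_add natDegree_X_le (natDegree_mul_le_add h1 h3)).trans
          (by omega)
      · exact (natDegree_mul_le_add natDegree_one_sub_X_le (natDegree_mul_le_add h2 h4)).trans
          (by omega)
    · have := natDegree_add_le_max (natDegree_mul_le_add h1 h4) (natDegree_mul_le_add h2 h3)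
      omega

theorem isLukacsForm_C {c : ℝ} (hc : 0 ≤ c) : IsLukacsForm 0 (C c) :=
  Or.inl ⟨0, C √c, 0, rfl, by simp, Or.inl rfl, by rw [← C_pow, Real.sq_sqrt hc]; ring⟩

theorem isLukacsForm_linear {p q : ℝ} (hp : 0 ≤ p) (hq : 0 ≤ q) :
    IsLukacsForm 1 (C p * X + C q * (1 - X)) :=
  Or.inr ⟨0, C √p, C √q, rfl, by simp, by simp, by
    rw [← C_pow, ← C_pow, Real.sq_sqrt hp, Real.sq_sqrt hq]; ring⟩

/-- The identity `1 = x + (1 - x)` raises the formal degree by one; multiplication by this form pads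
constants. -/
theorem isLukacsForm_one (m : ℕ) : IsLukacsForm m 1 := by
  induction m with
  | zero => simpa using isLukacsForm_C zero_le_one
  | succ m ih =>
    have h := isLukacsForm_linear zero_le_one zero_le_one
    rw [show (C 1 * X + C 1 * (1 - X) : ℝ[X]) = 1 by simp] at h
    simpa using ih.mul h

/-- The values at `0` and `1` are `R²` and `S²`, which suggests for `β` the linear polynomial
running from `-R` to `S`. Comparing leading coefficients leaves `γ² = (R + S)² - 1`, nonnegative by
the triangle inequality. -/
theorem isLukacsForm_quadratic (z : ℂ) :
    IsLukacsForm 2 (X ^ 2 - C (2 * z.re) * X + C (‖z‖ ^ 2)) := by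
  set R := ‖z‖
  set S := ‖1 - z‖
  have hRS : 1 ≤ R + S := by
    have := norm_add_le z (1 - z)
    simpa using this
  have hR : R ^ 2 = z.re ^ 2 + z.im ^ 2 := by
    rw [← Complex.normSq_eq_norm_sq, Complex.normSq_apply]; ring
  have hS : S ^ 2 = (1 - z.re) ^ 2 + z.im ^ 2 := by
    rw [← Complex.normSq_eq_norm_sq, Complex.normSq_apply]; simp; ring
  have hγ : 0 ≤ (R + S) ^ 2 - 1 := by nlinarith
  refine Or.inl ⟨1, C (R + S) * X - C R, C √((R + S) ^ 2 - 1), rfl, ?_, Or.inr (by simp), ?_⟩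
  · exact natDegree_sub_le_max ((natDegree_C_mul_le _ _).trans natDegree_X_le) (by simp)
  · rw [← C_pow (n := 2) (a := √_), Real.sq_sqrt hγ]
    have h2 : 2 * z.re = 2 * (R + S) * R - ((R + S) ^ 2 - 1) := by linarith
    rw [h2]
    simp only [map_sub, map_mul, map_add, map_pow, C_1]
    have : (C 2 : ℝ[X]) = 2 := rfl
    rw [this]
    ring

theorem eval_nonneg_of_right {g : ℝ[X]} {a b : ℝ} (hab : a < b)
    (h : ∀ y ∈ Set.Ioo a b, 0 ≤ g.eval y) : 0 ≤ g.eval a := by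
  have ht : Filter.Tendsto (fun y => g.eval y) (nhdsWithin a (Set.Ioi a)) (nhds (g.eval a)) :=
    g.continuous.continuousAt.tendsto.mono_left nhdsWithin_le_nhds
  refine ge_of_tendsto ht ?_
  filter_upwards [Ioo_mem_nhdsGT hab] with y hy using h y hy

theorem eval_nonpos_of_left {g : ℝ[X]} {a b : ℝ} (hab : b < a)
    (h : ∀ y ∈ Set.Ioo b a, g.eval y ≤ 0) : g.eval a ≤ 0 := by
  have ht : Filter.Tendsto (fun y => g.eval y) (nhdsWithin a (Set.Iio a)) (nhds (g.eval a)) :=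
    g.continuous.continuousAt.tendsto.mono_left nhdsWithin_le_nhds
  refine le_of_tendsto ht ?_
  filter_upwards [Ioo_mem_nhdsLT hab] with y hy using h y hy

/-- The theorem of Markov and Lukács on polynomials that are nonnegative on an interval. -/
theorem isLukacsForm_of_nonneg (m : ℕ) (g : ℝ[X]) (hm : g.natDegree ≤ m)
    (hg : ∀ y ∈ Set.Ioo (0 : ℝ) 1, 0 ≤ g.eval y) : IsLukacsForm m g := by
  induction m using Nat.strong_induction_on generalizing g with
  | _ m ih =>
    by_cases hd : g.natDegree = 0
    · rw [eq_C_of_natDegree_eq_zero hd] at hg ⊢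
      have h0 := hg (1 / 2) ⟨by norm_num, by norm_num⟩
      rw [eval_C] at h0
      simpa using (isLukacsForm_C h0).mul (isLukacsForm_one m)
    have hg0 : g ≠ 0 := fun h => hd (by simp [h])
    have hdeg : ∀ {p q : ℝ[X]}, g = p * q → g.natDegree = p.natDegree + q.natDegree := by
      rintro p q rfl
      exact natDegree_mul (left_ne_zero_of_mul hg0) (right_ne_zero_of_mul hg0)
    obtain ⟨z, hz⟩ : ∃ z : ℂ, aeval z g = 0 :=
      IsAlgClosed.exists_aeval_eq_zero ℂ g (fun h => hd (natDegree_eq_zero_iff_degree_le_zero.2 h.le))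
    by_cases him : z.im = 0
    · obtain ⟨a, rfl⟩ : ∃ a : ℝ, z = a := ⟨z.re, by apply Complex.ext <;> simp [him]⟩
      have hroot : g.IsRoot a := by
        have h1 : aeval ((algebraMap ℝ ℂ) a) g = 0 := hz
        rw [aeval_algebraMap_apply] at h1
        simpa using h1
      obtain ⟨k, hk⟩ := dvd_iff_isRoot.2 hroot
      have hkd := hdeg hk
      rw [natDegree_X_sub_C] at hkd
      have hev : ∀ y, g.eval y = (y - a) * k.eval y := fun y => by rw [hk]; simp
      obtain ⟨m, rfl⟩ : ∃ m', m = m' + 1 := ⟨m - 1, by omega⟩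
      -- For a root outside `(0, 1)` the linear factor has constant sign on the interval; up to that
      -- sign it is interpolated from its nonnegative values at `0` and `1`.
      rcases le_or_gt a 0 with ha | ha
      · have h1 : IsLukacsForm m k := ih m (by omega) k (by omega) fun y hy => by
          have := hg y hy
          rw [hev] at this
          exact nonneg_of_mul_nonneg_right this (by linarith [hy.1])
        have h2 := isLukacsForm_linear (p := 1 - a) (q := -a) (by linarith) (by linarith)
        have h3 := h1.mul h2
        convert h3 using 1
        rw [hk]
        simp only [C_sub, C_neg, C_1]
        ring
      rcases le_or_gt 1 a with ha1 | ha1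
      · have h1 : IsLukacsForm m (-k) := ih m (by omega) (-k) (by rw [natDegree_neg]; omega)
          fun y hy => by
            have := hg y hy
            rw [hev] at this
            rw [eval_neg]
            have h4 : 0 ≤ (a - y) * (-k.eval y) := by linarith
            exact nonneg_of_mul_nonneg_right h4 (by linarith [hy.2])
        have h2 := isLukacsForm_linear (p := a - 1) (q := a) (by linarith) (by linarith)
        have h3 := h1.mul h2
        convert h3 using 1
        rw [hk]
        simp only [C_sub, C_1]
        ring
      -- At an interior root the cofactor is nonpositive on the left and nonnegative on the right,
      -- so it vanishes there too and a square can be split off.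
      · have hka : k.IsRoot a := by
          refine le_antisymm ?_ ?_
          · refine eval_nonpos_of_left ha fun y hy => ?_
            have := hg y ⟨hy.1, hy.2.trans ha1⟩
            rw [hev] at this
            have h4 : 0 ≤ (a - y) * (-k.eval y) := by linarith
            have := nonneg_of_mul_nonneg_right h4 (by linarith [hy.2])
            linarith
          · refine eval_nonneg_of_right ha1 fun y hy => ?_
            have := hg y ⟨ha.trans hy.1, hy.2⟩
            rw [hev] at this
            exact nonneg_of_mul_nonneg_right this (by linarith [hy.1])
        obtain ⟨l, hl⟩ := dvd_iff_isRoot.2 hka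
        have hgl : g = (X - C a) ^ 2 * l := by rw [hk, hl]; ring
        have hld := hdeg hgl
        rw [natDegree_pow, natDegree_X_sub_C] at hld
        have hevl : ∀ y, g.eval y = (y - a) ^ 2 * l.eval y := fun y => by rw [hgl]; simp
        obtain ⟨m, rfl⟩ : ∃ m', m = m' + 1 := ⟨m - 1, by omega⟩
        have hpos : ∀ y ∈ Set.Ioo (0 : ℝ) 1, y ≠ a → 0 ≤ l.eval y := fun y hy hya => by
          have := hg y hy
          rw [hevl] at this
          exact nonneg_of_mul_nonneg_right this (by positivity [sub_ne_zero.2 hya])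
        have h1 : IsLukacsForm m l := ih m (by omega) l (by omega) fun y hy => by
          by_cases hya : y = a
          · subst hya
            exact eval_nonneg_of_right ha1 fun x hx => hpos x ⟨ha.trans hx.1, hx.2⟩ hx.1.ne'
          · exact hpos y hy hya
        have h2 := isLukacsForm_quadratic (a : ℂ)
        have h3 := h1.mul h2
        convert h3 using 1
        rw [hgl]
        simp only [Complex.ofReal_re, Complex.norm_real, Real.norm_eq_abs, sq_abs, map_mul, map_pow]
        have : (C 2 : ℝ[X]) = 2 := rfl
        rw [this]
        ring
    · obtain ⟨k, hk⟩ := g.quadratic_dvd_of_aeval_eq_zero_im_ne_zero hz him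
      have hkd := hdeg hk
      have hq : (X ^ 2 - C (2 * z.re) * X + C (‖z‖ ^ 2) : ℝ[X]).natDegree = 2 := by
        compute_degree!
      rw [hq] at hkd
      obtain ⟨m, rfl⟩ : ∃ m', m = m' + 2 := ⟨m - 2, by omega⟩
      have h1 : IsLukacsForm m k := ih m (by omega) k (by omega) fun y hy => by
        have := hg y hy
        rw [hk] at this
        simp only [eval_mul, eval_add, eval_sub, eval_pow, eval_X, eval_C] at this
        refine nonneg_of_mul_nonneg_right this ?_
        have h5 : 0 < z.im ^ 2 := by positivity
        have h6 : ‖z‖ ^ 2 = z.re ^ 2 + z.im ^ 2 := by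
          rw [← Complex.normSq_eq_norm_sq, Complex.normSq_apply]; ring
        rw [h6]
        nlinarith [sq_nonneg (y - z.re)]
      rw [hk, mul_comm]
      exact h1.mul (isLukacsForm_quadratic z)

/-- Phases of a quantum signal processing sequence of odd length for a real polynomial
`x a(x²)`. -/
theorem exists_phases (k : ℕ) (a : ℝ[X]) (ha : a.natDegree ≤ k)
    (hb : ∀ y ∈ Set.Ioo (0 : ℝ) 1, y * (a.eval y) ^ 2 ≤ 1) :
    ∃ Φ : List ℝ, Φ.length = 2 * k + 1 ∧
      (qspPair (1, 0) Φ).1 + (qspPair (1, 0) (Φ.map fun φ => -φ)).1 =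
        2 * (X * expand ℂ 2 (a.map (algebraMap ℝ ℂ))) := by
  have hform : IsLukacsForm (2 * k + 1) (1 - X * a ^ 2) := by
    refine isLukacsForm_of_nonneg _ _ ?_ fun y hy => ?_
    · refine natDegree_sub_le_max (by simp) ?_
      exact (natDegree_mul_le_add natDegree_X_le (natDegree_pow_le_of_le 2 ha)).trans (by omega)
    · simpa using hb y hy
  rcases hform with ⟨j, _, _, hj, _⟩ | ⟨j, β, γ, hj, hβ, hγ, heq⟩
  · omega
  obtain rfl : j = k := by omega
  set f := algebraMap ℝ ℂ with hf
  have hconj : ∀ p : ℝ[X], conjPoly (p.map f) = p.map f := fun p => by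
    rw [conjPoly, Polynomial.map_map]
    congr 1
    ext x
    simp [hf]
  set A := expand ℂ 2 (a.map f)
  set B := expand ℂ 2 (β.map f)
  set Q := expand ℂ 2 (γ.map f)
  have hA : conjPoly A = A := by rw [conjPoly, map_expand, ← conjPoly, hconj]
  have hB : conjPoly B = B := by rw [conjPoly, map_expand, ← conjPoly, hconj]
  have hQ : conjPoly Q = Q := by rw [conjPoly, map_expand, ← conjPoly, hconj]
  have hI : (C Complex.I * C Complex.I : ℂ[X]) = -1 := by
    rw [← C_mul, Complex.I_mul_I]; simp
  have hnorm : X ^ 2 * A ^ 2 + X ^ 2 * B ^ 2 + (1 - X ^ 2) * Q ^ 2 = 1 := by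
    have := congrArg (fun p : ℝ[X] => expand ℂ 2 (p.map f)) heq
    simp only [Polynomial.map_sub, Polynomial.map_add, Polynomial.map_mul, Polynomial.map_pow,
      Polynomial.map_one, map_X, map_sub, map_add, map_mul, map_pow, map_one, expand_X] at this
    linear_combination -this
  -- With `y = x²` the Lukács form of `1 - y a²` reads `1 = x² a² + x² β² + (1 - x²) γ²`. The first
  -- two squares combine to `|P|²` for real `x`, and the wanted polynomial is the real part of `P`.
  set P := X * (A + C Complex.I * B) with hPdef
  have hPc : conjPoly P = X * (A - C Complex.I * B) := by
    rw [conjPoly] at hA hB ⊢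
    simp only [hPdef, Polynomial.map_mul, Polynomial.map_add, map_X, map_C, hA, hB,
      Complex.conj_I, C_neg]
    ring
  have hcoeff : ∀ {p : ℂ[X]} {i : ℕ}, p.natDegree ≤ j → (expand ℂ 2 p).coeff i ≠ 0 →
      ∃ l, i = 2 * l ∧ l ≤ j := by
    intro p i hp hi
    rw [coeff_expand (by norm_num)] at hi
    split_ifs at hi with h2
    · obtain ⟨l, rfl⟩ := h2
      refine ⟨l, rfl, ?_⟩
      rw [Nat.mul_div_cancel_left _ (by norm_num)] at hi
      exact (le_natDegree_of_ne_zero hi).trans hp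
    · exact absurd rfl hi
  obtain ⟨Φ, hlen, hΦ⟩ := exists_qspPair_fst_eq (2 * j) P Q (by
      intro i hi
      rcases i with _ | i
      · simp [hPdef] at hi
      · have : P = X * expand ℂ 2 (a.map f + C Complex.I * β.map f) := by
          simp [hPdef, A, B]
        rw [this, coeff_X_mul] at hi
        obtain ⟨l, rfl, hl⟩ := hcoeff (by
          refine natDegree_add_le_of_degree_le (natDegree_map_le.trans ha) ?_
          exact (natDegree_C_mul_le _ _).trans (natDegree_map_le.trans hβ)) hi
        exact ⟨by omega, ⟨j + l + 1, by ring⟩⟩)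
    (by
      intro i hi
      obtain ⟨l, rfl, hl⟩ := hcoeff (natDegree_map_le.trans hγ) hi
      exact ⟨by omega, ⟨j + l, by ring⟩⟩)
    (by
      rw [hPc, hQ, hPdef]
      linear_combination hnorm - X ^ 2 * B ^ 2 * hI)
  refine ⟨Φ, hlen, ?_⟩
  have hneg := qspPair_neg (1, 0) Φ
  have h10 : (conjPoly (1 : ℂ[X]), conjPoly (0 : ℂ[X])) = (1, 0) := by simp
  simp only [h10] at hneg
  rw [hneg]
  simp only
  rw [hΦ, hPc, hPdef]
  ring

end Lukacs

/-! ### Polynomial approximations of the inverse and of the sign -/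

section Approximation

open Polynomial

/-- The Fejér kernel as a polynomial: `sin² φ * (fejer n).eval (sin² φ) = sin² (n φ)`. -/
noncomputable def fejer : ℕ → ℝ[X]
  | 0 => 0
  | 1 => 1
  | n + 2 => C 2 * (1 - C 2 * X) * fejer (n + 1) - fejer n + C 2

theorem fejer_eval_add_two (n : ℕ) (y : ℝ) :
    (fejer (n + 2)).eval y = 2 * (1 - 2 * y) * (fejer (n + 1)).eval y - (fejer n).eval y + 2 := by
  simp [fejer]

theorem natDegree_fejer_le (n : ℕ) : (fejer n).natDegree ≤ n := by
  induction n using Nat.twoStepInduction with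
  | zero => simp [fejer]
  | one => simp [fejer]
  | more n h1 h2 =>
    have h3 : (C 2 * (1 - C 2 * X) : ℝ[X]).natDegree ≤ 1 := by compute_degree
    refine natDegree_add_le_max (natDegree_sub_le_max ?_ (h1.trans (by omega))) (by simp)
    exact (natDegree_mul_le_add h3 h2).trans (by omega)

theorem fejer_eval_sin_sq (φ : ℝ) (n : ℕ) :
    Real.sin φ ^ 2 * (fejer n).eval (Real.sin φ ^ 2) = Real.sin (n * φ) ^ 2 := by
  induction n using Nat.twoStepInduction with
  | zero => simp [fejer]
  | one => simp [fejer]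
  | more n h1 h2 =>
    have e2 : Real.sin ((n + 2 : ℕ) * φ) =
        2 * Real.cos φ * Real.sin ((n + 1 : ℕ) * φ) - Real.sin (n * φ) := by
      have a1 : ((n + 2 : ℕ) : ℝ) * φ = (n + 1 : ℕ) * φ + φ := by push_cast; ring
      have a2 : (n : ℝ) * φ = (n + 1 : ℕ) * φ - φ := by push_cast; ring
      rw [a1, a2, Real.sin_add, Real.sin_sub]
      ring
    have e3 : Real.sin ((n + 1 : ℕ) * φ) =
        Real.sin (n * φ) * Real.cos φ + Real.cos (n * φ) * Real.sin φ := by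
      rw [← Real.sin_add]; push_cast; ring_nf
    rw [fejer_eval_add_two, e2]
    have p1 := Real.sin_sq_add_cos_sq φ
    have p2 := Real.sin_sq_add_cos_sq (n * φ)
    have h4 : Real.sin φ ^ 2 * (2 * (1 - 2 * Real.sin φ ^ 2) *
        (fejer (n + 1)).eval (Real.sin φ ^ 2) - (fejer n).eval (Real.sin φ ^ 2) + 2) =
        2 * (1 - 2 * Real.sin φ ^ 2) * Real.sin ((n + 1 : ℕ) * φ) ^ 2 - Real.sin (n * φ) ^ 2
          + 2 * Real.sin φ ^ 2 := by
      rw [← h1, ← h2]; ring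
    rw [h4, e3]
    generalize Real.sin φ = s at *
    generalize Real.cos φ = c at *
    generalize Real.sin (n * φ) = S at *
    generalize Real.cos (n * φ) = K at *
    have p1' : s ^ 2 = 1 - c ^ 2 := by linarith
    have p2' : K ^ 2 = 1 - S ^ 2 := by linarith
    ring_nf
    simp only [show s ^ 4 = (s ^ 2) ^ 2 by ring, show s ^ 3 = s * s ^ 2 by ring, p1', p2']
    ring_nf

theorem exists_sin_sq_eq {y : ℝ} (h0 : 0 ≤ y) (h1 : y ≤ 1) : ∃ φ : ℝ, Real.sin φ ^ 2 = y :=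
  ⟨Real.arcsin √y, by
    rw [Real.sin_arcsin (by linarith [Real.sqrt_nonneg y]) (Real.sqrt_le_one.2 h1),
      Real.sq_sqrt h0]⟩

theorem fejer_eval_nonneg {y : ℝ} (h0 : 0 < y) (h1 : y ≤ 1) (n : ℕ) : 0 ≤ (fejer n).eval y := by
  obtain ⟨φ, rfl⟩ := exists_sin_sq_eq h0.le h1
  have := fejer_eval_sin_sq φ n
  exact nonneg_of_mul_nonneg_right (this ▸ sq_nonneg _) h0

theorem mul_fejer_eval_le_one {y : ℝ} (h0 : 0 < y) (h1 : y ≤ 1) (n : ℕ) :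
    y * (fejer n).eval y ≤ 1 := by
  obtain ⟨φ, rfl⟩ := exists_sin_sq_eq h0.le h1
  rw [fejer_eval_sin_sq φ n]
  exact Real.sin_sq_le_one _

/-- The defect `n² - fejer n` has second difference `4 y` times the value of `fejer (n + 1)`, hence
between `0` and `4 y (n + 1)²`. Summing twice gives the bounds, so the induction carries the defect
and its first difference together. -/
theorem fejer_eval_bounds {y : ℝ} (h0 : 0 < y) (h1 : y ≤ 1) (n : ℕ) :
    (fejer n).eval y ≤ n ^ 2 ∧ (n : ℝ) ^ 2 - (fejer n).eval y ≤ y * (n ^ 4 - n ^ 2) / 3 := by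
  have key : ∀ n : ℕ, (0 ≤ (n : ℝ) ^ 2 - (fejer n).eval y) ∧
      (0 ≤ (((n + 1 : ℕ) : ℝ) ^ 2 - (fejer (n + 1)).eval y) - ((n : ℝ) ^ 2 - (fejer n).eval y)) ∧
      ((n : ℝ) ^ 2 - (fejer n).eval y ≤ y * (n ^ 4 - n ^ 2) / 3) ∧
      ((((n + 1 : ℕ) : ℝ) ^ 2 - (fejer (n + 1)).eval y) - ((n : ℝ) ^ 2 - (fejer n).eval y) ≤
        y * ((n + 1) ^ 4 - (n + 1) ^ 2 - (n ^ 4 - n ^ 2)) / 3) := by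
    intro n
    induction n with
    | zero => simp [fejer]
    | succ n ih =>
      obtain ⟨i1, i2, i3, i4⟩ := ih
      have hs := fejer_eval_nonneg h0 h1 (n + 1)
      have hE : 0 ≤ (((n + 1 : ℕ) : ℝ) ^ 2 - (fejer (n + 1)).eval y) := by linarith
      have hy1 : 0 ≤ y * (fejer (n + 1)).eval y := mul_nonneg h0.le hs
      have hy2 := mul_nonneg h0.le hE
      rw [fejer_eval_add_two]
      push_cast at *
      refine ⟨hE, ?_, ?_, ?_⟩ <;> nlinarith
  exact ⟨by linarith [(key n).1], (key n).2.2.1⟩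

theorem fejer_eval_zero (n : ℕ) : (fejer n).eval 0 = n ^ 2 := by
  induction n using Nat.twoStepInduction with
  | zero => simp [fejer]
  | one => simp [fejer]
  | more n h1 h2 => rw [fejer_eval_add_two, h1, h2]; push_cast; ring

/-- The probability of at most `l` successes in `2 l + 1` independent trials. -/
noncomputable def minority (l : ℕ) : ℝ[X] :=
  ∑ j ∈ Finset.range (l + 1), bernsteinPolynomial ℝ (2 * l + 1) j

theorem natDegree_minority_le (l : ℕ) : (minority l).natDegree ≤ 2 * l + 1 := by
  refine natDegree_sum_le_of_forall_le _ _ fun j hj => ?_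
  have hj' := Finset.mem_range.1 hj
  rw [bernsteinPolynomial]
  have h1 : ((1 - X : ℝ[X]) ^ (2 * l + 1 - j)).natDegree ≤ 2 * l + 1 - j := by
    simpa using natDegree_pow_le_of_le (2 * l + 1 - j) natDegree_one_sub_X_le
  have h2 : (((2 * l + 1).choose j : ℝ[X]) * X ^ j).natDegree ≤ 0 + j :=
    natDegree_mul_le_add (by simp) (by simp)
  exact (natDegree_mul_le_add h2 h1).trans (by omega)

theorem bernstein_eval (n j : ℕ) (r : ℝ) :
    (bernsteinPolynomial ℝ n j).eval r = n.choose j * (r ^ j * (1 - r) ^ (n - j)) := by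
  simp [bernsteinPolynomial, mul_assoc]

theorem minority_eval_nonneg (l : ℕ) {r : ℝ} (h0 : 0 ≤ r) (h1 : r ≤ 1) :
    0 ≤ (minority l).eval r := by
  rw [minority, eval_finsetSum]
  refine Finset.sum_nonneg fun j _ => ?_
  rw [bernstein_eval]
  have : 0 ≤ 1 - r := by linarith
  positivity

theorem one_sub_minority_eval (l : ℕ) (r : ℝ) : 1 - (minority l).eval r =
    ∑ j ∈ Finset.range (l + 1), (bernsteinPolynomial ℝ (2 * l + 1) (l + 1 + j)).eval r := by
  have h := congrArg (fun p : ℝ[X] => p.eval r) (bernsteinPolynomial.sum ℝ (2 * l + 1))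
  simp only [eval_finsetSum, eval_one] at h
  rw [show 2 * l + 1 + 1 = (l + 1) + (l + 1) by ring, Finset.sum_range_add] at h
  rw [minority, eval_finsetSum]
  linarith

theorem minority_eval_le_one (l : ℕ) {r : ℝ} (h0 : 0 ≤ r) (h1 : r ≤ 1) :
    (minority l).eval r ≤ 1 := by
  have h := one_sub_minority_eval l r
  have : 0 ≤ 1 - (minority l).eval r := by
    rw [h]
    refine Finset.sum_nonneg fun j _ => ?_
    rw [bernstein_eval]
    have : 0 ≤ 1 - r := by linarith
    positivity
  linarith

theorem minority_eval_one (l : ℕ) : (minority l).eval 1 = 0 := by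
  rw [minority, eval_finsetSum]
  refine Finset.sum_eq_zero fun j hj => ?_
  have := Finset.mem_range.1 hj
  rw [bernstein_eval, sub_self, zero_pow (by omega)]
  simp

theorem pow_mul_pow_le {r s : ℝ} {l j : ℕ} (hr : 0 ≤ r) (hs : 0 ≤ s) (hsr : s ≤ r) (hj : j ≤ l) :
    r ^ j * s ^ (2 * l + 1 - j) ≤ s * (r * s) ^ l := by
  obtain ⟨i, rfl⟩ : ∃ i, l = j + i := ⟨l - j, by omega⟩
  have h1 : s ^ i ≤ r ^ i := pow_le_pow_left₀ hs hsr i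
  have h2 : 2 * (j + i) + 1 - j = j + i + i + 1 := by omega
  rw [h2]
  calc r ^ j * s ^ (j + i + i + 1) = (r ^ j * s ^ j * s * s ^ i) * s ^ i := by ring
    _ ≤ (r ^ j * s ^ j * s * s ^ i) * r ^ i := by gcongr
    _ = s * (r * s) ^ (j + i) := by ring

/-- Every term is at most its binomial coefficient times `(1 - r) (r (1 - r)) ^ l`; half of the
binomial coefficients add up to `4 ^ l`, and `4 r (1 - r) ≤ 1`. That the bound does not depend on
`l` keeps the inverse polynomial bounded near `0`. -/
theorem minority_eval_le (l : ℕ) {r : ℝ} (h0 : 1 / 2 ≤ r) (h1 : r ≤ 1) :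
    (minority l).eval r ≤ 1 - r := by
  have hs : 0 ≤ 1 - r := by linarith
  have h4 : 4 * (r * (1 - r)) ≤ 1 := by nlinarith [sq_nonneg (2 * r - 1)]
  have h5 : 0 ≤ 4 * (r * (1 - r)) := by nlinarith
  calc (minority l).eval r
      ≤ ∑ j ∈ Finset.range (l + 1), ((2 * l + 1).choose j : ℝ) * ((1 - r) * (r * (1 - r)) ^ l) := by
        rw [minority, eval_finsetSum]
        refine Finset.sum_le_sum fun j hj => ?_
        have := Finset.mem_range.1 hj
        rw [bernstein_eval]
        refine mul_le_mul_of_nonneg_left ?_ (Nat.cast_nonneg _)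
        exact pow_mul_pow_le (by linarith) hs (by linarith) (by omega)
    _ = (1 - r) * (4 * (r * (1 - r))) ^ l := by
        rw [← Finset.sum_mul]
        have := Nat.sum_range_choose_halfway l
        have h6 : (∑ j ∈ Finset.range (l + 1), ((2 * l + 1).choose j : ℝ)) = 4 ^ l := by
          exact_mod_cast this
        rw [h6, mul_pow 4]
        generalize r * (1 - r) = w
        ring
    _ ≤ (1 - r) * 1 := by gcongr; exact pow_le_one₀ h5 h4
    _ = 1 - r := mul_one _

theorem one_sub_minority_eval_le (l : ℕ) {r : ℝ} (h0 : 0 ≤ r) (h1 : r ≤ 1 / 2) :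
    1 - (minority l).eval r ≤ (4 * (r * (1 - r))) ^ l := by
  have hs : 0 ≤ 1 - r := by linarith
  calc 1 - (minority l).eval r
      ≤ ∑ j ∈ Finset.range (l + 1), ((2 * l + 1).choose (l - j) : ℝ) * (r * ((1 - r) * r) ^ l) := by
        rw [one_sub_minority_eval]
        refine Finset.sum_le_sum fun j hj => ?_
        have := Finset.mem_range.1 hj
        rw [bernstein_eval, ← Nat.choose_symm (by omega : l + 1 + j ≤ 2 * l + 1),
          show 2 * l + 1 - (l + 1 + j) = l - j by omega,
          mul_comm (r ^ _)]
        refine mul_le_mul_of_nonneg_left ?_ (Nat.cast_nonneg _)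
        have := pow_mul_pow_le (l := l) (j := l - j) hs h0 (by linarith) (by omega)
        rwa [show 2 * l + 1 - (l - j) = l + 1 + j by omega] at this
    _ = r * (4 * (r * (1 - r))) ^ l := by
        rw [← Finset.sum_mul]
        have := Nat.sum_range_choose_halfway l
        have h6 : (∑ j ∈ Finset.range (l + 1), ((2 * l + 1).choose (l - j) : ℝ)) = 4 ^ l := by
          rw [← Finset.sum_range_reflect] at this
          simp only [Nat.add_sub_cancel] at this
          exact_mod_cast this
        rw [h6, mul_comm (1 - r), mul_pow 4]
        generalize r * (1 - r) = w
        ring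
    _ ≤ 1 * (4 * (r * (1 - r))) ^ l := by gcongr; linarith
    _ = (4 * (r * (1 - r))) ^ l := one_mul _

/-- A polynomial `x a(x²)` that is bounded by `1` on `[-1, 1]` and approximates `1 / (2 κ x)` for
`1 / κ ≤ |x| ≤ 1`. -/
theorem exists_inverse_polynomial (κ : ℝ) (hκ0 : 0 < κ) (hκ : 2 ≤ κ ^ 2) (l : ℕ) :
    ∃ a : ℝ[X], a.natDegree ≤ (2 * l + 1) * ⌈3 / 2 * κ⌉₊ ∧
      (∀ y ∈ Set.Ioo (0 : ℝ) 1, y * (a.eval y) ^ 2 ≤ 1) ∧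
      ∀ y : ℝ, 1 / κ ^ 2 ≤ y → y ≤ 1 → |2 * κ * (y * a.eval y) - 1| ≤ (80 / 81) ^ l := by
  -- The factor `3 / 2` makes the normalized kernel at most `1 / (N² y) ≤ 4 / 9` for `y ≥ 1 / κ²`.
  -- For such values `r` one has `4 r (1 - r) ≤ 80 / 81`, the rate in the conclusion.
  set N := ⌈3 / 2 * κ⌉₊ with hN
  have hN1 : 3 / 2 * κ ≤ N := Nat.le_ceil _
  have hN2 : (N : ℝ) < 3 / 2 * κ + 1 := Nat.ceil_lt_add_one (by positivity)
  have hNpos : (0 : ℝ) < N := by linarith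
  have hκ7 : 1.4 ≤ κ := by nlinarith
  set F : ℝ[X] := C (1 / (N : ℝ) ^ 2) * fejer N with hF
  have hFe : ∀ y, F.eval y = (fejer N).eval y / N ^ 2 := fun y => by
    simp [hF]; ring
  -- The normalized kernel equals `1` at `0`, where the minority polynomial vanishes; this makes the
  -- division by `y` exact.
  have hroot : ((minority l).comp F).IsRoot 0 := by
    rw [IsRoot, eval_comp, hFe, fejer_eval_zero, div_self (by positivity), minority_eval_one]
  obtain ⟨q, hq⟩ := dvd_iff_isRoot.2 hroot
  rw [C_0, sub_zero] at hq
  have hqe : ∀ y, y * q.eval y = (minority l).eval (F.eval y) := fun y => by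
    have := congrArg (fun p : ℝ[X] => p.eval y) hq
    simpa [eval_comp] using this.symm
  have hae : ∀ y, 2 * κ * (y * (C (1 / (2 * κ)) * q).eval y) = (minority l).eval (F.eval y) :=
    fun y => by
      rw [← hqe, eval_mul, eval_C]
      field_simp
  have hF0 : ∀ y, 0 < y → y ≤ 1 → 0 ≤ F.eval y ∧ F.eval y ≤ 1 := fun y h0 h1 => by
    rw [hFe]
    refine ⟨div_nonneg (fejer_eval_nonneg h0 h1 N) (by positivity), ?_⟩
    rw [div_le_one (by positivity)]
    exact (fejer_eval_bounds h0 h1 N).1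
  refine ⟨C (1 / (2 * κ)) * q, ?_, ?_, ?_⟩
  · refine (natDegree_C_mul_le _ _).trans ?_
    have h1 : q.natDegree ≤ ((minority l).comp F).natDegree := by
      by_cases hq0 : q = 0
      · simp [hq0]
      · rw [hq, natDegree_X_mul hq0]; omega
    refine h1.trans (natDegree_comp_le.trans ?_)
    exact Nat.mul_le_mul (natDegree_minority_le l)
      ((natDegree_C_mul_le _ _).trans (natDegree_fejer_le N))
  · intro y hy
    have hy0 : 0 < y := hy.1
    have e := hae y
    set v := (C (1 / (2 * κ)) * q).eval y
    obtain ⟨f0, f1⟩ := hF0 y hy.1 hy.2.le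
    set r := F.eval y with hr
    have g0 := minority_eval_nonneg l f0 f1
    have g1 := minority_eval_le_one l f0 f1
    have hr1 : 1 - r ≤ y * N ^ 2 / 3 := by
      have hb := (fejer_eval_bounds hy.1 hy.2.le N).2
      rw [hr, hFe, one_sub_div (by positivity), div_le_iff₀ (by positivity)]
      refine hb.trans ?_
      have : 0 ≤ y * (N : ℝ) ^ 2 := by positivity
      linarith
    -- This is the bound `y a² ≤ 1` after clearing `2 κ y`. It is trivial unless `y < 1 / (4 κ²)`;
    -- there `N² ≤ 5 κ²` (from `κ ≥ 1.4`) forces `r ≥ 1 / 2`, and the minority value is at most `1 -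
    -- r`, which is linear in `y`.
    have hg : ((minority l).eval r) ^ 2 ≤ 4 * κ ^ 2 * y := by
      by_cases hc : 1 ≤ 4 * κ ^ 2 * y
      · exact (pow_le_one₀ g0 g1).trans hc
      · have hNκ : (N : ℝ) ^ 2 ≤ 5 * κ ^ 2 := by nlinarith
        have h2 : y * N ^ 2 ≤ 5 * κ ^ 2 * y := by nlinarith
        have h3 : 1 / 2 ≤ r := by linarith
        have h4 := minority_eval_le l h3 f1
        have h5 : (minority l).eval r ≤ 5 / 3 * κ ^ 2 * y := by linarith
        have h6 : 0 ≤ κ ^ 2 * y := by positivity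
        calc ((minority l).eval r) ^ 2 ≤ (5 / 3 * κ ^ 2 * y) ^ 2 := by gcongr
          _ = 25 / 9 * (κ ^ 2 * y) * (κ ^ 2 * y) := by ring
          _ ≤ 25 / 9 * (κ ^ 2 * y) * 1 := by gcongr; linarith
          _ ≤ 4 * κ ^ 2 * y := by linarith
    rw [← e] at hg
    have h7 : 4 * κ ^ 2 * y * (y * v ^ 2) ≤ 4 * κ ^ 2 * y * 1 := by nlinarith
    exact le_of_mul_le_mul_left h7 (by positivity)
  · intro y hy0 hy1
    have hy : 0 < y := lt_of_lt_of_le (by positivity) hy0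
    rw [hae]
    obtain ⟨f0, f1⟩ := hF0 y hy hy1
    have hr : F.eval y ≤ 4 / 9 := by
      have h1 := mul_fejer_eval_le_one hy hy1 N
      rw [hFe, div_le_iff₀ (by positivity)]
      have h2 : 1 ≤ κ ^ 2 * y := by
        rw [div_le_iff₀ (by positivity)] at hy0; linarith
      have h3 : 9 / 4 * κ ^ 2 ≤ N ^ 2 := by nlinarith
      have hs := fejer_eval_nonneg hy hy1 N
      have h4 : (fejer N).eval y ≤ κ ^ 2 := by
        calc (fejer N).eval y = (fejer N).eval y * 1 := by ring
          _ ≤ (fejer N).eval y * (κ ^ 2 * y) := by gcongr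
          _ = κ ^ 2 * (y * (fejer N).eval y) := by ring
          _ ≤ κ ^ 2 * 1 := by gcongr
          _ = κ ^ 2 := mul_one _
      linarith
    set r := F.eval y
    have g1 := minority_eval_le_one l f0 f1
    rw [abs_sub_comm, abs_of_nonneg (by linarith)]
    refine (one_sub_minority_eval_le l f0 (by linarith)).trans ?_
    refine pow_le_pow_left₀ (by nlinarith) ?_ l
    nlinarith

/-- A polynomial `x a(x²)` that is bounded by `1` on `[-1, 1]` and at least `4 / 5` for
`x₀ ≤ x ≤ 1`. -/
theorem exists_sign_polynomial (x₀ : ℝ) (h0 : 0 < x₀) :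
    ∃ a : ℝ[X], (∀ y ∈ Set.Ioo (0 : ℝ) 1, y * (a.eval y) ^ 2 ≤ 1) ∧
      ∀ x, x₀ ≤ x → x ≤ 1 → 4 / 5 ≤ x * a.eval (x ^ 2) := by
  -- Newton's iteration `u ↦ u (3 - u²) / 2` for the sign, started at `u = x`. It preserves the
  -- shape `x a(x²)`, does not decrease `u` on `[0, 1]`, and multiplies `1 - u` by `1 - u (1 + u) /
  -- 2 ≤ 1 - x₀ / 2` once `u ≥ x₀`.
  have key : ∀ j : ℕ, ∃ a : ℝ[X], ∀ x : ℝ, 0 ≤ x → x ≤ 1 → 0 ≤ x * a.eval (x ^ 2) ∧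
      x * a.eval (x ^ 2) ≤ 1 ∧ (x₀ ≤ x → x₀ ≤ x * a.eval (x ^ 2) ∧
        1 - x * a.eval (x ^ 2) ≤ (1 - x₀ / 2) ^ j) := by
    intro j
    induction j with
    | zero =>
      refine ⟨1, fun x hx0 hx1 => ?_⟩
      simp only [eval_one, mul_one, pow_zero]
      exact ⟨hx0, hx1, fun h => ⟨h, by linarith⟩⟩
    | succ j ih =>
      obtain ⟨a, ha⟩ := ih
      refine ⟨C (1 / 2) * a * (3 - X * a ^ 2), fun x hx0 hx1 => ?_⟩
      obtain ⟨i1, i2, i3⟩ := ha x hx0 hx1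
      have e : x * (C (1 / 2) * a * (3 - X * a ^ 2)).eval (x ^ 2) =
          (x * a.eval (x ^ 2)) * (3 - (x * a.eval (x ^ 2)) ^ 2) / 2 := by
        simp
        ring
      rw [e]
      generalize x * a.eval (x ^ 2) = u at *
      refine ⟨by nlinarith, by nlinarith [sq_nonneg (1 - u)], fun hx => ?_⟩
      obtain ⟨i4, i5⟩ := i3 hx
      refine ⟨by nlinarith [mul_nonneg i1 (sub_nonneg.2 i2)], ?_⟩
      calc 1 - u * (3 - u ^ 2) / 2 = (1 - u) * (1 - u * (1 + u) / 2) := by ring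
        _ ≤ (1 - x₀ / 2) ^ j * (1 - x₀ / 2) := by
          gcongr
          · nlinarith [mul_nonneg i1 (sub_nonneg.2 i2)]
          · nlinarith
          · nlinarith [mul_nonneg i1 i1]
        _ = (1 - x₀ / 2) ^ (j + 1) := by ring
  obtain ⟨j, hj⟩ := exists_pow_lt_of_lt_one (show (0 : ℝ) < 1 / 5 by norm_num)
    (show 1 - x₀ / 2 < 1 by linarith)
  obtain ⟨a, ha⟩ := key j
  refine ⟨a, fun y hy => ?_, fun x hx0 hx1 => ?_⟩
  · obtain ⟨i1, i2, -⟩ := ha √y (Real.sqrt_nonneg _) (Real.sqrt_le_one.2 hy.2.le)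
    rw [Real.sq_sqrt hy.1.le] at i1 i2
    have := pow_le_one₀ (n := 2) i1 i2
    rwa [mul_pow, Real.sq_sqrt hy.1.le] at this
  · obtain ⟨-, -, i3⟩ := ha x (h0.le.trans hx0) hx1
    linarith [(i3 hx0).2]

end Approximation

/-! ### From signal processing to singular value transformation -/

section SingularValueTransformation

open Polynomial

variable {m n : Type} [Fintype m] [Fintype n] [DecidableEq m] [DecidableEq n]

theorem phaseOp_mul_iso {G : Matrix m n ℂ} (hG : IsIso G) (φ : ℝ) :
    phaseOp G φ * G = Complex.exp (φ * Complex.I) • G := by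
  have h : G * Gᴴ * G = G := by rw [Matrix.mul_assoc, show Gᴴ * G = 1 from hG, Matrix.mul_one]
  rw [phaseOp, Matrix.add_mul, Matrix.smul_mul, Matrix.smul_mul, Matrix.sub_mul, h,
    Matrix.one_mul, sub_self, smul_zero, add_zero]

theorem phaseOp_mul_of_orthogonal {k : Type} (G : Matrix m n ℂ) (φ : ℝ) {W : Matrix m k ℂ}
    (hW : Gᴴ * W = 0) : phaseOp G φ * W = Complex.exp (-(φ * Complex.I)) • W := by
  rw [phaseOp, Matrix.add_mul, Matrix.smul_mul, Matrix.smul_mul, Matrix.sub_mul,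
    Matrix.mul_assoc, hW, Matrix.mul_zero, Matrix.one_mul, sub_zero, smul_zero, zero_add]

/-- The alternating product of `U`, `U†` and phase operators; `U` is applied first. -/
noncomputable def altSeq (U : Matrix m m ℂ) (G : Matrix m n ℂ) : List ℝ → Matrix m m ℂ
  | [] => 1
  | φ :: Φ => altSeq Uᴴ G Φ * (phaseOp G φ * U)

theorem op_qsvt {k : Type} [DecidableEq k] {G : Matrix m n ℂ} (hG : IsIso G)
    (U₁ : Matrix m m ℂ) (U₂ : Matrix k k ℂ) (inv : Bool) (Φ : List ℝ) :
    Circuit.op U₁ U₂ (qsvt (k := k) hG inv Φ) =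
      blockDiagonal fun j : Fin 2 =>
        altSeq (dirOp inv U₁) G (if j = 0 then Φ else Φ.map fun φ => -φ) := by
  induction Φ generalizing inv with
  | nil =>
    have : (fun j : Fin 2 => altSeq (dirOp inv U₁) G
        (if j = 0 then [] else [].map fun φ : ℝ => -φ)) = 1 := by
      funext j
      simp [altSeq]
    rw [this, blockDiagonal_one]
    rfl
  | cons φ Φ ih =>
    simp only [qsvt, Circuit.op, ih, Gate.op]
    have h1 : onReg (Equiv.refl (m × Fin 2)) Finset.univ (dirOp inv U₁) =
        blockDiagonal fun _ : Fin 2 => dirOp inv U₁ := by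
      simp [onReg, controlled]
    rw [h1, ctrlPhase, ← blockDiagonal_mul, ← blockDiagonal_mul]
    congr 1
    funext j
    fin_cases j <;> simp [altSeq, dirOp_not, Matrix.mul_assoc]

/-- The control qubit in the state `|+⟩` averages the two branches. With phases `Φ` and `-Φ` this is
the real part that `exists_phases` provides. -/
theorem plusIso_mul_blockDiagonal (G : Matrix m n ℂ) (M : Fin 2 → Matrix m m ℂ) :
    (plusIso G)ᴴ * blockDiagonal M * plusIso G =
      (2⁻¹ : ℂ) • (Gᴴ * M 0 * G + Gᴴ * M 1 * G) := by
  have h2 : (((Real.sqrt 2 : ℝ) : ℂ)⁻¹) * ((Real.sqrt 2 : ℝ) : ℂ)⁻¹ = 2⁻¹ := by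
    rw [← mul_inv, ← Complex.ofReal_mul, Real.mul_self_sqrt (by norm_num)]
    norm_num
  ext i j
  simp only [Matrix.mul_apply, plusIso, Matrix.conjTranspose_apply, Fintype.sum_prod_type,
    Fin.sum_univ_two, blockDiagonal_apply', Matrix.smul_apply, Matrix.add_apply, smul_eq_mul,
    Finset.sum_add_distrib]
  simp only [star_mul', Complex.star_def, map_inv₀, Complex.conj_ofReal, if_true, mul_zero,
    Finset.sum_const_zero, add_zero, zero_add, one_ne_zero, if_false, zero_ne_one]
  rw [mul_add, Finset.mul_sum, Finset.mul_sum, ← h2]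
  simp only [Finset.sum_mul, Finset.mul_sum]
  congr 1 <;>
  · refine Finset.sum_congr rfl fun x _ => Finset.sum_congr rfl fun y _ => ?_
    ring

theorem isIso_plusIso {G : Matrix m n ℂ} (hG : IsIso G) : IsIso (plusIso G) := by
  have h := plusIso_mul_blockDiagonal G 1
  rw [blockDiagonal_one, Matrix.mul_one] at h
  rw [IsIso, h]
  simp only [Pi.one_apply, Matrix.mul_one, show Gᴴ * G = 1 from hG]
  rw [← two_smul ℂ (1 : Matrix n n ℂ), smul_smul]
  norm_num

/-- The action of a quantum signal processing sequence for a Hermitian unitary. -/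
theorem altSeq_mul_of_hermitian {V : Matrix m m ℂ} (hV : Vᴴ = V) (hVV : V * V = 1)
    {G : Matrix m n ℂ} (hG : IsIso G) (Φ : List ℝ) (p : ℂ[X] × ℂ[X]) :
    altSeq V G Φ * (G * aeval (Gᴴ * V * G) p.1 +
        (V * G - G * (Gᴴ * V * G)) * aeval (Gᴴ * V * G) p.2) =
      G * aeval (Gᴴ * V * G) (qspPair p Φ).1 +
        (V * G - G * (Gᴴ * V * G)) * aeval (Gᴴ * V * G) (qspPair p Φ).2 := by
  induction Φ generalizing p with
  | nil => simp [altSeq, qspPair]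
  | cons φ Φ ih =>
    have hq : qspPair p (φ :: Φ) = qspPair (qspStep (Complex.exp (φ * Complex.I))
        (Complex.exp (-(φ * Complex.I))) p) Φ := rfl
    rw [altSeq, hV, hq, ← ih, Matrix.mul_assoc]
    congr 1
    set H := Gᴴ * V * G with hH
    -- `W` is the part of `V G` orthogonal to the range of `G`; it plays the role of `√(1 - x²)`. As
    -- `V` maps `G` to `G H + W` and `W` to `G (1 - H²) - W H`, it acts on combinations `G P(H) + W
    -- Q(H)` as the reflection does in `qspStep`.
    set W := V * G - G * H with hW
    have hGW : Gᴴ * W = 0 := by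
      rw [hW, Matrix.mul_sub, ← Matrix.mul_assoc, ← Matrix.mul_assoc,
        show Gᴴ * G = 1 from hG, Matrix.one_mul, hH, sub_self]
    have h1 : V * G = G * H + W := by rw [hW]; abel
    have h2 : V * W = G * (1 - H ^ 2) - W * H := by
      rw [hW, Matrix.mul_sub, ← Matrix.mul_assoc V V, hVV, Matrix.one_mul, ← Matrix.mul_assoc V G,
        h1]
      simp only [Matrix.add_mul, Matrix.mul_sub, Matrix.mul_one, hW, Matrix.sub_mul, pow_two,
        Matrix.mul_assoc]
      abel
    have h3 : V * (G * aeval H p.1 + W * aeval H p.2) =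
        G * aeval H (X * p.1 + (1 - X ^ 2) * p.2) + W * aeval H (p.1 - X * p.2) := by
      simp only [map_add, map_mul, map_sub, aeval_X, map_one, map_pow]
      rw [Matrix.mul_add, ← Matrix.mul_assoc, h1, ← Matrix.mul_assoc V, h2]
      simp only [Matrix.add_mul, Matrix.mul_sub, Matrix.mul_add, Matrix.sub_mul, Matrix.mul_assoc]
      abel
    rw [Matrix.mul_assoc, h3, Matrix.mul_add, ← Matrix.mul_assoc, phaseOp_mul_iso hG,
      ← Matrix.mul_assoc, phaseOp_mul_of_orthogonal G φ hGW]
    simp only [qspStep, map_mul, aeval_C, Algebra.algebraMap_eq_smul_one, smul_mul_assoc, one_mul,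
      Matrix.mul_smul, Matrix.smul_mul]

theorem phaseOp_fromBlocks (G : Matrix m n ℂ) (φ : ℝ) :
    phaseOp (fromBlocks G 0 0 G) φ = fromBlocks (phaseOp G φ) 0 0 (phaseOp G φ) := by
  rw [phaseOp, fromBlocks_conjTranspose, fromBlocks_multiply, ← fromBlocks_one]
  simp [-fromBlocks_one, phaseOp, fromBlocks_smul, fromBlocks_add, sub_eq_add_neg,
    fromBlocks_neg]

/-- The Hermitian dilation swaps the two summands each time it acts, so its repeated use alternates
`U` and `Uᴴ` automatically. The parity of the length decides in which blocks the words end up. -/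
theorem altSeq_fromBlocks (U : Matrix m m ℂ) (G : Matrix m n ℂ) (Φ : List ℝ) :
    altSeq (fromBlocks 0 Uᴴ U 0) (fromBlocks G 0 0 G) Φ =
      if Even Φ.length then fromBlocks (altSeq U G Φ) 0 0 (altSeq Uᴴ G Φ)
      else fromBlocks 0 (altSeq Uᴴ G Φ) (altSeq U G Φ) 0 := by
  have hd : (fromBlocks 0 Uᴴ U 0)ᴴ = fromBlocks 0 Uᴴ U 0 := by
    simp [fromBlocks_conjTranspose]
  induction Φ with
  | nil => simp [altSeq]
  | cons φ Φ ih =>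
    rw [altSeq, hd, ih, phaseOp_fromBlocks]
    by_cases h : Even Φ.length
    · have h' : ¬ Even (φ :: Φ).length := by simpa [Nat.even_add_one] using h
      rw [if_pos h, if_neg h']
      simp [fromBlocks_multiply, altSeq]
    · have h' : Even (φ :: Φ).length := by simpa [Nat.even_add_one] using h
      rw [if_neg h, if_pos h']
      simp [fromBlocks_multiply, altSeq]

theorem aeval_fromBlocks_diagonal (A B : Matrix n n ℂ) (p : ℂ[X]) :
    aeval (fromBlocks A 0 0 B) p = fromBlocks (aeval A p) 0 0 (aeval B p) := by
  induction p using Polynomial.induction_on' with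
  | add p q hp hq => simp [hp, hq, fromBlocks_add]
  | monomial k c =>
    have h : ∀ k : ℕ, fromBlocks A 0 0 B ^ k = fromBlocks (A ^ k) 0 0 (B ^ k) := by
      intro k
      induction k with
      | zero => simp
      | succ k ih => rw [pow_succ, ih, fromBlocks_multiply]; simp [pow_succ]
    rw [aeval_monomial, aeval_monomial, aeval_monomial, h]
    simp [Algebra.algebraMap_eq_smul_one, fromBlocks_smul]

/-- The block encoded operator of an alternating sequence of odd length. -/
theorem conj_altSeq_eq {U : Matrix m m ℂ} (hU : U ∈ Matrix.unitaryGroup m ℂ)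
    {G : Matrix m n ℂ} (hG : IsIso G) {Φ : List ℝ} (hΦ : Odd Φ.length) :
    Gᴴ * altSeq U G Φ * G =
      (aeval (fromBlocks 0 (Gᴴ * U * G)ᴴ (Gᴴ * U * G) 0) (qspPair (1, 0) Φ).1).toBlocks₂₁ := by
  have hU1 : U * Uᴴ = 1 := Matrix.mem_unitaryGroup_iff.1 hU
  have hU2 : Uᴴ * U = 1 := Matrix.mem_unitaryGroup_iff'.1 hU
  set V : Matrix (m ⊕ m) (m ⊕ m) ℂ := fromBlocks 0 Uᴴ U 0 with hV
  set E : Matrix (m ⊕ m) (n ⊕ n) ℂ := fromBlocks G 0 0 G with hE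
  have hGG : Gᴴ * G = 1 := hG
  have hVH : Vᴴ = V := by simp [hV, fromBlocks_conjTranspose]
  have hVV : V * V = 1 := by simp [hV, fromBlocks_multiply, hU1, hU2]
  have hEE : IsIso E := by
    rw [IsIso, hE, fromBlocks_conjTranspose, fromBlocks_multiply]
    simp [hGG]
  have hH : Eᴴ * V * E = fromBlocks 0 (Gᴴ * U * G)ᴴ (Gᴴ * U * G) 0 := by
    simp [hE, hV, fromBlocks_conjTranspose, fromBlocks_multiply, Matrix.mul_assoc]
  have key := altSeq_mul_of_hermitian hVH hVV hEE Φ (1, 0)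
  simp only [map_one, map_zero, Matrix.mul_one, Matrix.mul_zero, add_zero] at key
  have key2 := congrArg (fun M => (Eᴴ * M).toBlocks₂₁) key
  rw [Matrix.mul_add, ← Matrix.mul_assoc Eᴴ E, show Eᴴ * E = 1 from hEE, Matrix.one_mul,
    ← Matrix.mul_assoc Eᴴ (V * E - _), Matrix.mul_sub, ← Matrix.mul_assoc Eᴴ E,
    show Eᴴ * E = 1 from hEE, Matrix.one_mul, ← Matrix.mul_assoc Eᴴ V, sub_self,
    Matrix.zero_mul, add_zero, hH, hV, hE, altSeq_fromBlocks,
    if_neg (Nat.not_even_iff_odd.2 hΦ)] at key2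
  rw [← key2]
  simp [fromBlocks_conjTranspose, fromBlocks_multiply, Matrix.mul_assoc]

/-- Quantum singular value transformation for a real polynomial `x a(x²)` that is bounded by `1`
on `[-1, 1]`. -/
theorem exists_qsvt (k : ℕ) (a : ℝ[X]) (ha : a.natDegree ≤ k)
    (hb : ∀ y ∈ Set.Ioo (0 : ℝ) 1, y * (a.eval y) ^ 2 ≤ 1) :
    ∃ Φ : List ℝ, Φ.length = 2 * k + 1 ∧
      ∀ {m n l : Type} [Fintype m] [Fintype n] [DecidableEq m] [DecidableEq n] [DecidableEq l]
        {G : Matrix m n ℂ} (hG : IsIso G) {U : Matrix m m ℂ} (_ : U ∈ Matrix.unitaryGroup m ℂ)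
        (U₂ : Matrix l l ℂ) (inv : Bool),
        (plusIso G)ᴴ * Circuit.op U U₂ (qsvt hG inv Φ) * plusIso G =
          (Gᴴ * dirOp inv U * G) *
            aeval ((Gᴴ * dirOp inv U * G)ᴴ * (Gᴴ * dirOp inv U * G)) a := by
  obtain ⟨Φ, hlen, hΦ⟩ := exists_phases k a ha hb
  refine ⟨Φ, hlen, ?_⟩
  intro m n l _ _ _ _ _ G hG U hU U₂ inv
  have hodd : Odd Φ.length := ⟨k, hlen⟩
  have hU' := dirOp_unitary inv hU
  rw [op_qsvt, plusIso_mul_blockDiagonal]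
  simp only [if_true, one_ne_zero, if_false]
  rw [conj_altSeq_eq hU' hG hodd, conj_altSeq_eq hU' hG (by simpa using hodd)]
  generalize Gᴴ * dirOp inv U * G = Z
  have h : ∀ A B : Matrix (n ⊕ n) (n ⊕ n) ℂ,
      A.toBlocks₂₁ + B.toBlocks₂₁ = (A + B).toBlocks₂₁ := fun _ _ => rfl
  have h2 : (2 : ℂ[X]) = C 2 := rfl
  -- The square of the dilation of `Z` is block diagonal with `Zᴴ Z` in the upper block, so `x
  -- a(x²)` has `Z a(Zᴴ Z)` as its lower left block.
  rw [h, ← map_add, hΦ, h2, map_mul, map_mul, expand_aeval, aeval_X, pow_two,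
    fromBlocks_multiply]
  simp only [Matrix.zero_mul, Matrix.mul_zero, add_zero, zero_add]
  rw [aeval_fromBlocks_diagonal, fromBlocks_multiply, aeval_C, Algebra.algebraMap_eq_smul_one,
    smul_mul_assoc, one_mul, fromBlocks_smul, toBlocks_fromBlocks₂₁, smul_smul,
    aeval_map_algebraMap]
  simp

end SingularValueTransformation

/-! ### Extension of isometries to unitaries -/

section Completion

variable {X n : Type} [Fintype X] [DecidableEq X] [Fintype n] [DecidableEq n]

theorem inner_toEuclideanLin_of_isIso {E : Matrix X n ℂ} (hE : IsIso E) (x y : EuclideanSpace ℂ n) :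
    inner ℂ (toEuclideanLin E x) (toEuclideanLin E y) = inner ℂ x y := by
  rw [EuclideanSpace.inner_eq_star_dotProduct, EuclideanSpace.inner_eq_star_dotProduct]
  simp only [Matrix.ofLp_toLpLin, Matrix.toLin'_apply]
  rw [Matrix.star_mulVec, dotProduct_comm, ← Matrix.dotProduct_mulVec, Matrix.mulVec_mulVec,
    show Eᴴ * E = 1 from hE, Matrix.one_mulVec, dotProduct_comm]

theorem isIso_of_inner {W : Matrix X n ℂ}
    (h : ∀ x y, inner ℂ (toEuclideanLin W x) (toEuclideanLin W y) = inner ℂ x y) : IsIso W := by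
  rw [IsIso]
  ext i j
  have := h (EuclideanSpace.single i 1) (EuclideanSpace.single j 1)
  rw [EuclideanSpace.inner_eq_star_dotProduct, EuclideanSpace.inner_eq_star_dotProduct] at this
  simp only [Matrix.ofLp_toLpLin, Matrix.toLin'_apply, PiLp.ofLp_single] at this
  rw [Matrix.mulVec_single_one, Matrix.mulVec_single_one] at this
  simp only [dotProduct, Matrix.col_apply, Pi.star_apply] at this
  rw [Matrix.mul_apply]
  simp only [Matrix.conjTranspose_apply]
  rw [Finset.sum_congr rfl fun x _ => mul_comm (star (W x i)) (W x j), this]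
  simp [Pi.single_apply, Matrix.one_apply, eq_comm]

/-- Two isometries with the same domain and codomain differ by a unitary. -/
theorem exists_unitary_mul_eq {E F : Matrix X n ℂ} (hE : IsIso E) (hF : IsIso F) :
    ∃ W ∈ Matrix.unitaryGroup X ℂ, W * E = F := by
  let E' := (toEuclideanLin E).isometryOfInner (inner_toEuclideanLin_of_isIso hE)
  let F' := (toEuclideanLin F).isometryOfInner (inner_toEuclideanLin_of_isIso hF)
  -- `E x ↦ F x` is an isometry on the range of `E`. In finite dimension it extends to an isometry
  -- of the whole space, which is unitary.
  let L : LinearMap.range E'.toLinearMap →ₗᵢ[ℂ] EuclideanSpace ℂ X :=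
    F'.comp E'.equivRange.symm.toLinearIsometry
  have hL : ∀ x, L.extend (E' x) = F' x := by
    intro x
    have h1 := L.extend_apply (E'.equivRange x)
    have h2 : L (E'.equivRange x) = F' x := by
      simp [L]
    rw [← h2, ← h1]
    rfl
  let W : Matrix X X ℂ := toEuclideanLin.symm L.extend.toLinearMap
  have hW : ∀ x, toEuclideanLin W x = L.extend x := fun x => by simp [W]
  refine ⟨W, ?_, ?_⟩
  · rw [Matrix.mem_unitaryGroup_iff', Matrix.star_eq_conjTranspose]
    refine isIso_of_inner fun x y => ?_
    rw [hW, hW, LinearIsometry.inner_map_map]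
  · refine Matrix.ext_of_mulVec_single fun i => ?_
    rw [← Matrix.mulVec_mulVec]
    have h := hL (WithLp.toLp 2 (Pi.single i 1))
    rw [← hW] at h
    have h' := congrArg WithLp.ofLp h
    simpa [E', F', Matrix.ofLp_toLpLin, Matrix.toLin'_apply] using h'

/-- Two pairs of isometries with orthogonal ranges differ by a unitary. -/
theorem exists_unitary_mul_eq_pair {E₀ E₁ F₀ F₁ : Matrix X n ℂ} (hE₀ : IsIso E₀) (hE₁ : IsIso E₁)
    (hE : E₀ᴴ * E₁ = 0) (hF₀ : IsIso F₀) (hF₁ : IsIso F₁) (hF : F₀ᴴ * F₁ = 0) :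
    ∃ W ∈ Matrix.unitaryGroup X ℂ, W * E₀ = F₀ ∧ W * E₁ = F₁ := by
  have key : ∀ {A B : Matrix X n ℂ}, IsIso A → IsIso B → Aᴴ * B = 0 → IsIso (fromCols A B) := by
    intro A B hA hB hAB
    have hBA : Bᴴ * A = 0 := by
      have := congrArg Matrix.conjTranspose hAB
      simpa using this
    rw [IsIso, conjTranspose_fromCols_eq_fromRows_conjTranspose, fromRows_mul_fromCols, hAB, hBA,
      show Aᴴ * A = 1 from hA, show Bᴴ * B = 1 from hB, fromBlocks_one]
  obtain ⟨W, hW, h⟩ := exists_unitary_mul_eq (key hE₀ hE₁ hE) (key hF₀ hF₁ hF)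
  rw [mul_fromCols] at h
  exact ⟨W, hW, fromCols_inj h⟩

/-- A contraction and its defect operator extend to a unitary. -/
theorem exists_unitary_mul_eq_add {E₀ E₁ : Matrix X n ℂ} (hE₀ : IsIso E₀) (hE₁ : IsIso E₁)
    (hE : E₀ᴴ * E₁ = 0) {M N : Matrix n n ℂ} (hMN : Mᴴ * M + Nᴴ * N = 1) :
    ∃ W ∈ Matrix.unitaryGroup X ℂ, W * E₀ = E₀ * M + E₁ * N := by
  refine exists_unitary_mul_eq hE₀ ?_
  have hE' : E₁ᴴ * E₀ = 0 := by
    have := congrArg Matrix.conjTranspose hE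
    simpa using this
  have c : ∀ (A B : Matrix X n ℂ) (P Q : Matrix n n ℂ), (A * P)ᴴ * (B * Q) = Pᴴ * (Aᴴ * B) * Q :=
    fun A B P Q => by simp only [conjTranspose_mul, Matrix.mul_assoc]
  rw [IsIso, conjTranspose_add, Matrix.add_mul, Matrix.mul_add, Matrix.mul_add, c, c, c, c, hE, hE',
    show E₀ᴴ * E₀ = 1 from hE₀, show E₁ᴴ * E₁ = 1 from hE₁]
  simpa using hMN

end Completion

/-! ### Operators at a fixed basis state of the complementary register -/

section Registers

variable {m k X : Type} [DecidableEq m] [Fintype m] [Fintype X] [DecidableEq X] {r : ℕ}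

/-- The operator `G ⊗ |j⟩` into the space `X`, which is identified by `e` with the tensor product
of the register `m` and an `r`-dimensional register. -/
def tensorKet (e : X ≃ m × Fin r) (j : Fin r) (G : Matrix m k ℂ) : Matrix X k ℂ :=
  fun x i => if (e x).2 = j then G (e x).1 i else 0

theorem tensorKet_mul [Fintype k] {l : Type} (e : X ≃ m × Fin r) (j : Fin r) (G : Matrix m k ℂ)
    (M : Matrix k l ℂ) : tensorKet e j G * M = tensorKet e j (G * M) := by
  ext x i
  simp only [tensorKet, Matrix.mul_apply]
  split_ifs <;> simp

theorem conjTranspose_tensorKet_mul {l : Type} (e : X ≃ m × Fin r) (j j' : Fin r)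
    (G : Matrix m k ℂ) (G' : Matrix m l ℂ) :
    (tensorKet e j G)ᴴ * tensorKet e j' G' = if j = j' then Gᴴ * G' else 0 := by
  ext i i'
  rw [Matrix.mul_apply, ← e.symm.sum_comp, Fintype.sum_prod_type]
  simp only [tensorKet, Matrix.conjTranspose_apply, Equiv.apply_symm_apply]
  by_cases h : j = j'
  · subst h
    simp [Matrix.mul_apply]
  · have : ∀ x : Fin r, ∀ a b : ℂ, star (if x = j then a else 0) * (if x = j' then b else 0) = 0 := by
      intro x a b
      by_cases h1 : x = j
      · subst h1; simp [h]
      · simp [h1]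
    simp only [this, if_neg h]
    simp

theorem onReg_mul_tensorKet (e : X ≃ m × Fin r) (U : Matrix m m ℂ) (j : Fin r)
    (G : Matrix m k ℂ) :
    onReg e Finset.univ U * tensorKet e j G = tensorKet e j (U * G) := by
  ext x i
  rw [Matrix.mul_apply, ← e.symm.sum_comp, Fintype.sum_prod_type]
  simp only [tensorKet, onReg, controlled, Equiv.apply_symm_apply, Matrix.submatrix_apply,
    Finset.mem_univ, if_true]
  generalize e x = z
  obtain ⟨a, b⟩ := z
  simp only [blockDiagonal_apply', Matrix.mul_apply]
  by_cases h : b = j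
  · subst h; simp
  · have : ∀ c : Fin r, ∀ p q : ℂ, (if b = c then p else 0) * (if c = j then q else 0) = 0 := by
      intro c p q
      by_cases h1 : b = c
      · subst h1; simp [h]
      · simp [h1]
    simp [this, h]

theorem isIso_tensorKet [DecidableEq k] (e : X ≃ m × Fin r) (j : Fin r) {G : Matrix m k ℂ}
    (hG : IsIso G) : IsIso (tensorKet e j G) := by
  rw [IsIso, conjTranspose_tensorKet_mul, if_pos rfl]
  exact hG

/-- The operator `I ⊗ |j⟩`. -/
abbrev registerKet (e : X ≃ m × Fin r) (j : Fin r) : Matrix X m ℂ := tensorKet e j 1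

end Registers

/-! ### Preconditioned block encoding and amplitude amplification -/

section BlockEncodings

theorem basis_projection {d : ℕ} (i : Fin d) :
    (vecMulVec (Pi.single i 1) (star (Pi.single i 1)) : Matrix (Fin d) (Fin d) ℂ) =
      Matrix.single i i 1 := by
  rw [Matrix.single_eq_single_vecMulVec_single, ← Pi.single_star, star_one]

theorem unitary_conj_vecMulVec {n : Type} [Fintype n] [DecidableEq n] (U : Matrix n n ℂ)
    (v : n → ℂ) :
    U * vecMulVec v (star v) * Uᴴ = vecMulVec (U *ᵥ v) (star (U *ᵥ v)) := by
  rw [Matrix.mul_vecMulVec, Matrix.vecMulVec_mul, Matrix.star_mulVec]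

theorem unitary_conj_scaling {n : Type} [Fintype n] [DecidableEq n] {U : Matrix n n ℂ}
    (hU : U ∈ Matrix.unitaryGroup n ℂ) (s : ℝ) (v : n → ℂ) :
    U * scaling s v * Uᴴ = scaling s (U *ᵥ v) := by
  have h : U * Uᴴ = 1 := Matrix.mem_unitaryGroup_iff.1 hU
  simp only [scaling, Matrix.mul_add, Matrix.add_mul, Matrix.mul_sub, Matrix.sub_mul,
    Matrix.mul_smul, Matrix.smul_mul, Matrix.mul_one, h, unitary_conj_vecMulVec]

theorem conjTranspose_scaling {n : Type} [DecidableEq n] (s : ℝ) (v : n → ℂ) :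
    (scaling s v)ᴴ = scaling s v := by
  simp [scaling, conjTranspose_vecMulVec]

theorem scaling_single {d : ℕ} (s : ℝ) (i : Fin d) :
    scaling s (Pi.single i 1) =
      Matrix.diagonal fun j : Fin d => if j = i then (s : ℂ) else 1 := by
  rw [scaling, basis_projection]
  ext j k
  by_cases hjk : j = k
  · subst hjk
    by_cases hji : j = i
    · subst hji; simp
    · simp [Matrix.single_apply_of_row_ne (Ne.symm hji), hji]
  · by_cases hji : i = j
    · subst hji; simp [hjk]
    · simp [Matrix.single_apply_of_row_ne hji, hjk]

/-- A circuit with one query to `U` and two queries to `V` or its inverse for the product of the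
scaling operator `s |b⟩⟨b| + (I - |b⟩⟨b|)`, where `b = V |0⟩`, and the operator `G† U G`. -/
theorem exists_scaled_block_encoding {d D : ℕ} [NeZero d] {G : Matrix (Fin D) (Fin d) ℂ}
    (hG : IsIso G) (s : ℝ) (hs : s ^ 2 ≤ 1) :
    ∃ (y : ℕ) (G' : Matrix (Fin y) (Fin d) ℂ) (_ : IsIso G')
      (P : Circuit (Fin D) (Fin d) (Fin y)), y ≠ 0 ∧
      Circuit.queries₁ P = 1 ∧ Circuit.queries₂ P = 2 ∧
      ∀ U ∈ Matrix.unitaryGroup (Fin D) ℂ, ∀ V ∈ Matrix.unitaryGroup (Fin d) ℂ,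
        G'ᴴ * Circuit.op U V P * G' = scaling s (V *ᵥ Pi.single 0 1) * (Gᴴ * U * G) := by
  have hd : 0 < d := Nat.pos_of_ne_zero (NeZero.ne d)
  have hD : 0 < D := by
    refine Nat.pos_of_ne_zero fun h => ?_
    subst h
    have h1 := congrFun (congrFun (show Gᴴ * G = 1 from hG) 0) 0
    simp [Matrix.mul_apply] at h1
  -- One space of dimension `2 d D` contains both oracle registers. The factor `2` leaves room for
  -- two orthogonal flag states next to either register.
  let e₁ : Fin (D * (2 * d)) ≃ Fin D × Fin (2 * d) := Fintype.equivOfCardEq (by simp)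
  let e₂ : Fin (D * (2 * d)) ≃ Fin d × Fin (2 * D) := Fintype.equivOfCardEq (by simp; ring)
  let i₀ : Fin (2 * d) := ⟨0, by omega⟩
  let i₁ : Fin (2 * d) := ⟨1, by omega⟩
  let j₀ : Fin (2 * D) := ⟨0, by omega⟩
  let j₁ : Fin (2 * D) := ⟨1, by omega⟩
  have hi : i₀ ≠ i₁ := by simp [i₀, i₁]
  have hj : j₀ ≠ j₁ := by simp [j₀, j₁]
  have h1 : IsIso (1 : Matrix (Fin d) (Fin d) ℂ) := by simp [IsIso]
  set M : Matrix (Fin d) (Fin d) ℂ := scaling s (Pi.single 0 1) with hM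
  set N : Matrix (Fin d) (Fin d) ℂ :=
    Matrix.diagonal fun j : Fin d => if j = 0 then ((√(1 - s ^ 2) : ℝ) : ℂ) else 0 with hN
  have hMN : Mᴴ * M + Nᴴ * N = 1 := by
    have hsq : (√(1 - s ^ 2) : ℂ) * √(1 - s ^ 2) = 1 - s ^ 2 := by
      rw [← Complex.ofReal_mul, Real.mul_self_sqrt (by linarith)]
      push_cast
      ring
    rw [hM, scaling_single, hN, diagonal_conjTranspose, diagonal_conjTranspose,
      diagonal_mul_diagonal, diagonal_mul_diagonal, diagonal_add, ← diagonal_one]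
    congr 1
    funext j
    by_cases h : j = 0
    · simp [h, hsq]; ring
    · simp [h]
  have or₁ : (tensorKet e₁ i₀ G)ᴴ * tensorKet e₁ i₁ G = 0 := by
    rw [conjTranspose_tensorKet_mul, if_neg hi]
  have or₂ : (registerKet e₂ j₀)ᴴ * registerKet e₂ j₁ = 0 := by
    rw [conjTranspose_tensorKet_mul, if_neg hj]
  -- In the adjoint direction, `W₃` decodes the range of `G'` into the register of `V`, `W₂`
  -- performs the scaling at `|0⟩` with its defect in the second flag, and `W₁` encodes both flag
  -- branches by `G` again.
  obtain ⟨W₁, hW₁, hw₁⟩ := exists_unitary_mul_eq_pair (isIso_tensorKet e₂ j₀ h1)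
    (isIso_tensorKet e₂ j₁ h1) or₂ (isIso_tensorKet e₁ i₀ hG) (isIso_tensorKet e₁ i₁ hG) or₁
  obtain ⟨W₂, hW₂, hw₂⟩ := exists_unitary_mul_eq_add (isIso_tensorKet e₂ j₀ h1)
    (isIso_tensorKet e₂ j₁ h1) or₂ hMN
  obtain ⟨W₃, hW₃, hw₃⟩ := exists_unitary_mul_eq (isIso_tensorKet e₁ i₀ hG)
    (isIso_tensorKet e₂ j₀ h1)
  let P : Circuit (Fin D) (Fin d) (Fin (D * (2 * d))) :=
    [.query₁ false (2 * d) e₁ Finset.univ, .fixed (star W₁) (Unitary.star_mem hW₁),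
      .query₂ true (2 * D) e₂ Finset.univ, .fixed (star W₂) (Unitary.star_mem hW₂),
      .query₂ false (2 * D) e₂ Finset.univ, .fixed (star W₃) (Unitary.star_mem hW₃)]
  refine ⟨_, tensorKet e₁ i₀ G, isIso_tensorKet e₁ i₀ hG, P, by positivity, rfl, rfl, ?_⟩
  intro U hU V hV
  set G' := tensorKet e₁ i₀ G with hG'
  -- The adjoint is easier to follow: the query to `U` comes last, so before it every intermediate
  -- state lies in the range of a known isometry. Forwards, `U` would leave the range of `G` at
  -- once.
  have hadj : (Circuit.op U V P)ᴴ * G' =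
      tensorKet e₁ i₀ (Uᴴ * (G * (V * M * Vᴴ))) + tensorKet e₁ i₁ (Uᴴ * (G * (V * N * Vᴴ))) := by
    have e : (Circuit.op U V P)ᴴ = onReg e₁ Finset.univ Uᴴ * (W₁ * (onReg e₂ Finset.univ V * (W₂ *
        (onReg e₂ Finset.univ Vᴴ * W₃)))) := by
      simp [P, Circuit.op, Gate.op, dirOp, conjTranspose_mul, onReg_conjTranspose,
        star_eq_conjTranspose, Matrix.mul_assoc]
    have a1 : W₃ * G' = registerKet e₂ j₀ := hw₃
    have a2 : onReg e₂ Finset.univ Vᴴ * registerKet e₂ j₀ = registerKet e₂ j₀ * Vᴴ := by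
      rw [onReg_mul_tensorKet, tensorKet_mul, Matrix.mul_one, Matrix.one_mul]
    have a3 : ∀ (j : Fin (2 * D)) (R : Matrix (Fin d) (Fin d) ℂ),
        onReg e₂ Finset.univ V * (registerKet e₂ j * R) = registerKet e₂ j * (V * R) := by
      intro j R
      rw [← Matrix.mul_assoc, onReg_mul_tensorKet, tensorKet_mul, tensorKet_mul, Matrix.mul_one,
        Matrix.one_mul]
    have a4 : W₂ * (registerKet e₂ j₀ * Vᴴ) =
        registerKet e₂ j₀ * (M * Vᴴ) + registerKet e₂ j₁ * (N * Vᴴ) := by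
      rw [← Matrix.mul_assoc, hw₂, Matrix.add_mul, Matrix.mul_assoc, Matrix.mul_assoc]
    rw [e]
    simp only [Matrix.mul_assoc]
    rw [a1, a2, a4, Matrix.mul_add, a3, a3, Matrix.mul_add, ← Matrix.mul_assoc W₁, hw₁.1,
      ← Matrix.mul_assoc W₁, hw₁.2, Matrix.mul_add, tensorKet_mul, tensorKet_mul,
      onReg_mul_tensorKet, onReg_mul_tensorKet]
  have hfin : G'ᴴ * ((Circuit.op U V P)ᴴ * G') = Gᴴ * (Uᴴ * (G * (V * M * Vᴴ))) := by
    rw [hadj, Matrix.mul_add, hG', conjTranspose_tensorKet_mul, conjTranspose_tensorKet_mul,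
      if_pos rfl, if_neg hi, add_zero]
  have hfin' := congrArg Matrix.conjTranspose hfin
  rw [hM, unitary_conj_scaling hV] at hfin'
  simpa only [conjTranspose_mul, conjTranspose_conjTranspose, conjTranspose_scaling,
    Matrix.mul_assoc] using hfin'

theorem aeval_mulVec_eq {n : Type} [Fintype n] [DecidableEq n] {A : Matrix n n ℂ} {x : n → ℂ}
    {c : ℝ} (h : A *ᵥ x = (c : ℂ) • x) (p : Polynomial ℝ) :
    Polynomial.aeval A p *ᵥ x = ((p.eval c : ℝ) : ℂ) • x := by
  induction p using Polynomial.induction_on' with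
  | add p q hp hq => simp [hp, hq, Matrix.add_mulVec, add_smul]
  | monomial k b =>
    have hk : A ^ k *ᵥ x = ((c : ℂ) ^ k) • x := by
      induction k with
      | zero => simp
      | succ k ih =>
        rw [pow_succ, ← Matrix.mulVec_mulVec, h, Matrix.mulVec_smul, ih, smul_smul, pow_succ,
          mul_comm]
    rw [Polynomial.aeval_monomial, Polynomial.eval_monomial, Algebra.algebraMap_eq_smul_one,
      smul_mul_assoc, one_mul, Matrix.smul_mulVec, hk]
    ext i
    simp [mul_assoc]

theorem flaggedState_eq {d w : ℕ} [NeZero d]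
    (V : Matrix (Fin d × Fin (w + 1)) (Fin d × Fin (w + 1)) ℂ) :
    flaggedState V = ((registerKet (Equiv.refl (Fin d × Fin (w + 1))) 0)ᴴ * V *
      registerKet (Equiv.refl (Fin d × Fin (w + 1))) 0) *ᵥ Pi.single 0 1 := by
  have h1 : registerKet (Equiv.refl (Fin d × Fin (w + 1))) 0 *ᵥ
      Pi.single 0 1 = Pi.single (0, 0) 1 := by
    rw [Matrix.mulVec_single_one]
    ext ⟨i, j⟩
    simp only [Matrix.col_apply, tensorKet, Equiv.refl_apply, Matrix.one_apply, Pi.single_apply,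
      Prod.mk.injEq]
    by_cases hi : i = 0 <;> by_cases hj : j = 0 <;> simp [hi, hj]
  rw [← Matrix.mulVec_mulVec, h1, ← Matrix.mulVec_mulVec]
  ext i
  rw [flaggedState]
  generalize V *ᵥ Pi.single (0, 0) 1 = u
  have h2 : ∀ x j, (registerKet (Equiv.refl (Fin d × Fin (w + 1))) 0)ᴴ i (x, j) =
      if j = 0 then (if x = i then 1 else 0) else 0 := by
    intro x j
    simp only [Matrix.conjTranspose_apply, tensorKet, Equiv.refl_apply, Matrix.one_apply]
    by_cases hj : j = 0 <;> by_cases hx : x = i <;> simp [hj, hx]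
  simp only [Matrix.mulVec, dotProduct, Fintype.sum_prod_type, h2]
  simp

theorem norm2_sq {n : Type} [Fintype n] (v : n → ℂ) : ((norm2 v ^ 2 : ℝ) : ℂ) = star v ⬝ᵥ v := by
  rw [norm2, EuclideanSpace.norm_sq_eq]
  simp only [dotProduct, Pi.star_apply, Complex.ofReal_sum]
  refine Finset.sum_congr rfl fun i _ => ?_
  rw [← Complex.normSq_eq_norm_sq, ← Complex.mul_conj, mul_comm]
  rfl

/-- Amplitude amplification: from an operator `Q` that block encodes a matrix, a circuit prepares
a multiple of the image of the state `V |0⟩`, where the amplitude is transformed by the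
polynomial `a`. -/
theorem exists_amplification_circuit {m : Type} [Fintype m] [DecidableEq m] [Nonempty m]
    {d : ℕ} [NeZero d] {G : Matrix m (Fin d) ℂ} (hG : IsIso G) (a : Polynomial ℝ)
    (hb : ∀ y ∈ Set.Ioo (0 : ℝ) 1, y * (a.eval y) ^ 2 ≤ 1) :
    ∃ (w : ℕ) (T : Circuit m (Fin d) (Fin d × Fin (w + 1))),
      Circuit.queries₁ T = 2 * a.natDegree + 1 ∧ Circuit.queries₂ T = 2 * a.natDegree + 1 ∧
      ∀ Q ∈ Matrix.unitaryGroup m ℂ, ∀ V ∈ Matrix.unitaryGroup (Fin d) ℂ, ∀ v : Fin d → ℂ,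
        v = (Gᴴ * Q * G) *ᵥ (V *ᵥ Pi.single 0 1) →
        flaggedState (Circuit.op Q V T) = ((a.eval (norm2 v ^ 2) : ℝ) : ℂ) • v := by
  obtain ⟨Φ, hlen, hΦ⟩ := exists_qsvt a.natDegree a le_rfl hb
  have hd : 0 < d := Nat.pos_of_ne_zero (NeZero.ne d)
  have hm : 0 < Fintype.card m := Fintype.card_pos
  set c := Fintype.card m with hc
  -- The workspace dimension `4 c` matches `d * (4 c)` with the dimension `2 c d` of the space of
  -- `C`, times the control qubit of the transformation.
  obtain ⟨w, hw⟩ : ∃ w, w + 1 = 4 * c := ⟨4 * c - 1, by omega⟩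
  let e₁ : Fin (c * (2 * d)) ≃ m × Fin (2 * d) := Fintype.equivOfCardEq (by simp [hc])
  let e₂ : Fin (c * (2 * d)) ≃ Fin d × Fin (2 * c) := Fintype.equivOfCardEq (by simp; ring)
  let e : Fin d × Fin (w + 1) ≃ (Fin (c * (2 * d)) × Fin 2) × Fin 1 :=
    Fintype.equivOfCardEq (by simp [hw]; ring)
  let i₀ : Fin (2 * d) := ⟨0, by omega⟩
  let i₁ : Fin (2 * d) := ⟨1, by omega⟩
  let j₀ : Fin (2 * c) := ⟨0, by omega⟩
  let j₁ : Fin (2 * c) := ⟨1, by omega⟩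
  have hi : i₀ ≠ i₁ := by simp [i₀, i₁]
  have hj : j₀ ≠ j₁ := by simp [j₀, j₁]
  have h1 : IsIso (1 : Matrix (Fin d) (Fin d) ℂ) := by simp [IsIso]
  -- Projecting the input onto `|0⟩` makes the encoded matrix `v ⟨0|`, of rank at most one. Its only
  -- possible nonzero singular value is the norm of `v`, so transforming singular values amplifies
  -- the amplitude.
  set p : Matrix (Fin d) (Fin d) ℂ := vecMulVec (Pi.single 0 1) (star (Pi.single 0 1)) with hp
  have hpp : pᴴ * p + (1 - p)ᴴ * (1 - p) = 1 := by
    rw [hp, basis_projection]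
    simp only [conjTranspose_sub, conjTranspose_one, conjTranspose_single, star_one,
      Matrix.sub_mul, Matrix.mul_sub, Matrix.single_mul_single_same,
      Matrix.one_mul, mul_one]
    abel
  have or₁ : (tensorKet e₁ i₀ G)ᴴ * tensorKet e₁ i₁ G = 0 := by
    rw [conjTranspose_tensorKet_mul, if_neg hi]
  have or₂ : (registerKet e₂ j₀)ᴴ * registerKet e₂ j₁ = 0 := by
    rw [conjTranspose_tensorKet_mul, if_neg hj]
  obtain ⟨W, hW, hw₀, hw₁⟩ := exists_unitary_mul_eq_pair (isIso_tensorKet e₂ j₀ h1)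
    (isIso_tensorKet e₂ j₁ h1) or₂ (isIso_tensorKet e₁ i₀ hG) (isIso_tensorKet e₁ i₁ hG) or₁
  obtain ⟨K, hK, hk⟩ := exists_unitary_mul_eq_add (isIso_tensorKet e₂ j₀ h1)
    (isIso_tensorKet e₂ j₁ h1) or₂ hpp
  set G₀ := registerKet e₂ j₀ with hG₀
  have hisoG₀ : IsIso G₀ := isIso_tensorKet e₂ j₀ h1
  let C : Circuit m (Fin d) (Fin (c * (2 * d))) :=
    [.fixed K hK, .query₂ false (2 * c) e₂ Finset.univ, .fixed W hW,
      .query₁ false (2 * d) e₁ Finset.univ, .fixed (star W) (Unitary.star_mem hW)]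
  have hC : ∀ Q V, G₀ᴴ * Circuit.op Q V C * G₀ = Gᴴ * Q * G * (V * p) := by
    intro Q V
    have a3 : ∀ (j : Fin (2 * c)) (R : Matrix (Fin d) (Fin d) ℂ),
        onReg e₂ Finset.univ V * (registerKet e₂ j * R) = registerKet e₂ j * (V * R) := by
      intro j R
      rw [← Matrix.mul_assoc, onReg_mul_tensorKet, tensorKet_mul, tensorKet_mul, Matrix.mul_one,
        Matrix.one_mul]
    have b1 : G₀ᴴ * Wᴴ = (tensorKet e₁ i₀ G)ᴴ := by
      rw [← conjTranspose_mul, hw₀]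
    have b2 : G₀ᴴ * Circuit.op Q V C * G₀ = (G₀ᴴ * Wᴴ) * (onReg e₁ Finset.univ Q *
        (W * (onReg e₂ Finset.univ V * (K * G₀)))) := by
      simp [C, Circuit.op, Gate.op, dirOp, star_eq_conjTranspose, Matrix.mul_assoc]
    rw [b2, b1, hk, Matrix.mul_add, a3, a3, Matrix.mul_add, ← Matrix.mul_assoc W, hw₀,
      ← Matrix.mul_assoc W, hw₁, tensorKet_mul, tensorKet_mul, Matrix.mul_add,
      onReg_mul_tensorKet, onReg_mul_tensorKet, Matrix.mul_add, conjTranspose_tensorKet_mul,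
      conjTranspose_tensorKet_mul, if_pos rfl, if_neg hi, add_zero]
    simp only [Matrix.mul_assoc]
  set J := registerKet (Equiv.refl (Fin d × Fin (w + 1))) 0 with hJ
  obtain ⟨R, hR, hr⟩ := exists_unitary_mul_eq (isIso_tensorKet (Equiv.refl _) 0 h1 : IsIso J)
    (isIso_tensorKet e 0 (isIso_plusIso hisoG₀))
  let T : Circuit m (Fin d) (Fin d × Fin (w + 1)) :=
    .fixed R hR :: ((Circuit.subst C (qsvt hisoG₀ false Φ)).map (Gate.lift e Finset.univ) ++
      [.fixed (star R) (Unitary.star_mem hR)])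
  refine ⟨w, T, ?_, ?_, ?_⟩
  · simp only [T, Circuit.queries₁, Circuit.queries₁_append, Circuit.queries₁_lift,
      Circuit.queries₁_subst, queries₁_qsvt, hlen, C]
    omega
  · simp only [T, Circuit.queries₂, Circuit.queries₂_append, Circuit.queries₂_lift,
      Circuit.queries₂_subst, queries₁_qsvt, queries₂_qsvt, hlen, C]
    omega
  intro Q hQ V hV v hv
  have hop : Circuit.op Q V T = Rᴴ * (onReg e Finset.univ
      (Circuit.op (Circuit.op Q V C) V (qsvt hisoG₀ false Φ)) * R) := by
    simp [T, Circuit.op, Circuit.op_append, Circuit.op_lift, Circuit.op_subst, Gate.op,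
      star_eq_conjTranspose, Matrix.mul_assoc]
  have hZ : G₀ᴴ * dirOp false (Circuit.op Q V C) * G₀ = vecMulVec v (star (Pi.single 0 1)) := by
    rw [show dirOp false (Circuit.op Q V C) = Circuit.op Q V C from rfl, hC, hp,
      Matrix.mul_vecMulVec, Matrix.mul_vecMulVec, ← hv]
  have hflag : Jᴴ * Circuit.op Q V T * J =
      (plusIso G₀)ᴴ * Circuit.op (Circuit.op Q V C) V (qsvt hisoG₀ false Φ) * plusIso G₀ := by
    have c1 : Jᴴ * Rᴴ = (tensorKet e 0 (plusIso G₀))ᴴ := by rw [← conjTranspose_mul, hr]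
    rw [hop]
    have c2 : ∀ O : Matrix (Fin d × Fin (w + 1)) (Fin d × Fin (w + 1)) ℂ,
        Jᴴ * (Rᴴ * (O * R)) * J = (Jᴴ * Rᴴ) * (O * (R * J)) := fun O => by
      simp only [Matrix.mul_assoc]
    rw [c2, c1, hr, onReg_mul_tensorKet, conjTranspose_tensorKet_mul, if_pos rfl,
      Matrix.mul_assoc]
  have hone : star (Pi.single 0 1 : Fin d → ℂ) ⬝ᵥ Pi.single 0 1 = 1 := by
    rw [dotProduct_single]; simp
  rw [flaggedState_eq, hflag, hΦ hisoG₀ (Circuit.op_unitary hQ hV C) V false, hZ,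
    ← Matrix.mulVec_mulVec]
  have heig : ((vecMulVec v (star (Pi.single (0 : Fin d) (1 : ℂ))))ᴴ *
      vecMulVec v (star (Pi.single (0 : Fin d) (1 : ℂ)))) *ᵥ
      (Pi.single 0 1 : Fin d → ℂ) = ((norm2 v ^ 2 : ℝ) : ℂ) • Pi.single 0 1 := by
    rw [conjTranspose_vecMulVec, star_star, vecMulVec_mul_vecMulVec, norm2_sq,
      Matrix.vecMulVec_smul, Matrix.smul_mulVec, vecMulVec_mulVec, hone]
    simp
  rw [aeval_mulVec_eq heig, Matrix.mulVec_smul, vecMulVec_mulVec, hone]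
  simp

end BlockEncodings

/-! ### Norm estimates for the preconditioned inverse -/

section Norms

variable {m n : Type} [Fintype m] [DecidableEq m] [Fintype n] [DecidableEq n]

theorem norm2_nonneg (v : n → ℂ) : 0 ≤ norm2 v := norm_nonneg _

theorem norm2_smul (z : ℂ) (v : n → ℂ) : norm2 (z • v) = ‖z‖ * norm2 v := by
  rw [norm2, WithLp.toLp_smul, norm_smul, norm2]

theorem norm2_mulVec_le (M : Matrix m n ℂ) (v : n → ℂ) : norm2 (M *ᵥ v) ≤ ‖M‖ * norm2 v :=
  M.l2_opNorm_mulVec (WithLp.toLp 2 v)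

theorem norm2_sub_le (v w : n → ℂ) : norm2 v - norm2 w ≤ norm2 (v - w) := by
  simpa [norm2, WithLp.toLp_sub] using norm_sub_norm_le (WithLp.toLp 2 v) (WithLp.toLp 2 w)

theorem norm2_sub_comm (v w : n → ℂ) : norm2 (v - w) = norm2 (w - v) := by
  rw [norm2, norm2, WithLp.toLp_sub, WithLp.toLp_sub, norm_sub_rev]

theorem norm2_single (i : n) : norm2 (Pi.single i 1 : n → ℂ) = 1 := by
  have := PiLp.norm_single 2 (fun _ : n => ℂ) i 1
  rw [norm_one] at this
  exact this

theorem norm2_mulVec_of_isIso {G : Matrix m n ℂ} (hG : IsIso G) (v : n → ℂ) :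
    norm2 (G *ᵥ v) = norm2 v := by
  have h : ((norm2 (G *ᵥ v) ^ 2 : ℝ) : ℂ) = ((norm2 v ^ 2 : ℝ) : ℂ) := by
    rw [norm2_sq, norm2_sq, Matrix.star_mulVec, ← Matrix.dotProduct_mulVec, Matrix.mulVec_mulVec,
      show Gᴴ * G = 1 from hG, Matrix.one_mulVec]
  exact (sq_eq_sq₀ (norm2_nonneg _) (norm2_nonneg _)).1 (by exact_mod_cast h)

theorem norm_le_of_mulVec {M : Matrix m n ℂ} {C : ℝ} (hC : 0 ≤ C)
    (h : ∀ v, norm2 (M *ᵥ v) ≤ C * norm2 v) : ‖M‖ ≤ C := by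
  rw [Matrix.l2_opNorm_def]
  refine ContinuousLinearMap.opNorm_le_bound _ hC fun x => ?_
  exact h x.ofLp

theorem norm_le_one_of_isIso {G : Matrix m n ℂ} (hG : IsIso G) : ‖G‖ ≤ 1 :=
  norm_le_of_mulVec zero_le_one fun v => by rw [norm2_mulVec_of_isIso hG, one_mul]

theorem norm_conj_isIso_le_one {G : Matrix m n ℂ} (hG : IsIso G) {U : Matrix m m ℂ}
    (hU : U ∈ Matrix.unitaryGroup m ℂ) : ‖Gᴴ * U * G‖ ≤ 1 := by
  have hG' := norm_le_one_of_isIso hG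
  have hU' : ‖U‖ ≤ 1 := norm_le_one_of_isIso (Matrix.mem_unitaryGroup_iff'.1 hU)
  have hG2 : ‖Gᴴ‖ ≤ 1 := by rwa [Matrix.l2_opNorm_conjTranspose]
  calc ‖Gᴴ * U * G‖ ≤ ‖Gᴴ * U‖ * ‖G‖ := Matrix.l2_opNorm_mul _ _
    _ ≤ (‖Gᴴ‖ * ‖U‖) * ‖G‖ := by gcongr; exact Matrix.l2_opNorm_mul _ _
    _ ≤ (1 * 1) * 1 := by gcongr
    _ = 1 := by norm_num

theorem norm2_star_dotProduct_le (u v : n → ℂ) : ‖star u ⬝ᵥ v‖ ≤ norm2 u * norm2 v := by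
  have := norm_inner_le_norm (𝕜 := ℂ) (WithLp.toLp 2 u) (WithLp.toLp 2 v)
  rwa [EuclideanSpace.inner_eq_star_dotProduct, dotProduct_comm] at this

theorem norm_vecMulVec_star_le (u : n → ℂ) : ‖vecMulVec u (star u)‖ ≤ norm2 u ^ 2 := by
  refine norm_le_of_mulVec (by positivity) fun v => ?_
  rw [vecMulVec_mulVec]
  have h : norm2 (MulOpposite.op (star u ⬝ᵥ v) • u) = ‖star u ⬝ᵥ v‖ * norm2 u := by
    rw [← norm2_smul]
    congr 1
    ext i
    simp [mul_comm]
  rw [h]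
  nlinarith [norm2_star_dotProduct_le u v, norm2_nonneg u]

theorem norm_le_one_of_projection {P : Matrix n n ℂ} (h1 : Pᴴ = P) (h2 : P * P = P) :
    ‖P‖ ≤ 1 := by
  have h := Matrix.l2_opNorm_conjTranspose_mul_self P
  rw [h1, h2] at h
  nlinarith [norm_nonneg P]

theorem scaling_mul_scaling_inv {b : n → ℂ} (hb : star b ⬝ᵥ b = 1) {s : ℝ} (hs : s ≠ 0) :
    scaling s b * scaling s⁻¹ b = 1 := by
  have hp : vecMulVec b (star b) * vecMulVec b (star b) = vecMulVec b (star b) := by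
    rw [vecMulVec_mul_vecMulVec, hb, one_smul]
  have hs' : (s : ℂ) ≠ 0 := by exact_mod_cast hs
  unfold scaling
  generalize vecMulVec b (star b) = p at hp ⊢
  simp only [add_mul, mul_add, smul_mul_smul_comm, mul_sub, sub_mul, hp, Matrix.one_mul,
    Matrix.mul_one, Matrix.smul_mul, Matrix.mul_smul]
  rw [Complex.ofReal_inv, mul_inv_cancel₀ hs']
  simp

theorem scaling_mulVec_self {b : n → ℂ} (hb : star b ⬝ᵥ b = 1) (s : ℝ) :
    scaling s b *ᵥ b = (s : ℂ) • b := by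
  rw [scaling, Matrix.add_mulVec, Matrix.sub_mulVec, Matrix.smul_mulVec, vecMulVec_mulVec, hb]
  simp

/-- The norm of the preconditioned inverse. -/
theorem norm_mul_scaling_le {b : n → ℂ} (hb : star b ⬝ᵥ b = 1) (N : Matrix n n ℂ) {s α β : ℝ}
    (hN : ‖N‖ ≤ α) (hNb : |s| * norm2 (N *ᵥ b) ≤ β * α) (hα : 0 ≤ α) :
    ‖N * scaling s b‖ ≤ √(β ^ 2 + 1) * α := by
  have hp : vecMulVec b (star b) * vecMulVec b (star b) = vecMulVec b (star b) := by
    rw [vecMulVec_mul_vecMulVec, hb, one_smul]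
  have hpH : (vecMulVec b (star b))ᴴ = vecMulVec b (star b) := by simp [conjTranspose_vecMulVec]
  -- `b bᴴ` and `1 - b bᴴ` are complementary projections, so there are no cross terms. Working with
  -- the square gives `√(β² + 1)` in place of `β + 1`.
  have h1 : (N * scaling s b) * (N * scaling s b)ᴴ =
      ((s : ℂ) ^ 2) • vecMulVec (N *ᵥ b) (star (N *ᵥ b)) +
        N * (1 - vecMulVec b (star b)) * Nᴴ := by
    rw [conjTranspose_mul, conjTranspose_scaling, ← unitary_conj_vecMulVec]
    have h2 : scaling s b * scaling s b =
        ((s : ℂ) ^ 2) • vecMulVec b (star b) + (1 - vecMulVec b (star b)) := by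
      unfold scaling
      generalize vecMulVec b (star b) = p at hp ⊢
      simp only [add_mul, mul_add, smul_mul_smul_comm, mul_sub, sub_mul, hp, Matrix.one_mul,
        Matrix.mul_one, Matrix.smul_mul, Matrix.mul_smul, pow_two]
      simp
    rw [show N * scaling s b * (scaling s b * Nᴴ) = N * (scaling s b * scaling s b) * Nᴴ by
      simp only [Matrix.mul_assoc], h2, Matrix.mul_add, Matrix.add_mul, Matrix.mul_smul,
      Matrix.smul_mul]
  have hproj : ‖(1 : Matrix n n ℂ) - vecMulVec b (star b)‖ ≤ 1 := by
    refine norm_le_one_of_projection ?_ ?_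
    · rw [conjTranspose_sub, hpH, conjTranspose_one]
    · rw [Matrix.mul_sub, Matrix.sub_mul, Matrix.sub_mul, hp]; simp
  have hsq : ‖N * scaling s b‖ * ‖N * scaling s b‖ ≤ (β ^ 2 + 1) * α ^ 2 := by
    have h3 := Matrix.l2_opNorm_conjTranspose_mul_self (N * scaling s b)ᴴ
    rw [conjTranspose_conjTranspose, Matrix.l2_opNorm_conjTranspose] at h3
    rw [← h3, h1]
    have h4 : ‖((s : ℂ) ^ 2) • vecMulVec (N *ᵥ b) (star (N *ᵥ b))‖ ≤ (β * α) ^ 2 := by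
      rw [norm_smul, norm_pow, Complex.norm_real, Real.norm_eq_abs]
      calc |s| ^ 2 * ‖vecMulVec (N *ᵥ b) (star (N *ᵥ b))‖ ≤ |s| ^ 2 * norm2 (N *ᵥ b) ^ 2 := by
            gcongr; exact norm_vecMulVec_star_le _
        _ = (|s| * norm2 (N *ᵥ b)) ^ 2 := by ring
        _ ≤ (β * α) ^ 2 := by
            have := norm2_nonneg (N *ᵥ b)
            gcongr
    have h5 : ‖N * (1 - vecMulVec b (star b)) * Nᴴ‖ ≤ α ^ 2 := by
      calc ‖N * (1 - vecMulVec b (star b)) * Nᴴ‖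
          ≤ ‖N * (1 - vecMulVec b (star b))‖ * ‖Nᴴ‖ := Matrix.l2_opNorm_mul _ _
        _ ≤ (‖N‖ * ‖(1 : Matrix n n ℂ) - vecMulVec b (star b)‖) * ‖Nᴴ‖ := by
            gcongr; exact Matrix.l2_opNorm_mul _ _
        _ = (‖N‖ * ‖(1 : Matrix n n ℂ) - vecMulVec b (star b)‖) * ‖N‖ := by
            rw [Matrix.l2_opNorm_conjTranspose]
        _ ≤ (α * 1) * α := by gcongr
        _ = α ^ 2 := by ring
    calc _ ≤ _ + _ := norm_add_le _ _
      _ ≤ (β * α) ^ 2 + α ^ 2 := add_le_add h4 h5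
      _ = (β ^ 2 + 1) * α ^ 2 := by ring
  refine le_of_sq_le_sq ?_ (by positivity)
  rw [mul_pow, Real.sq_sqrt (by positivity), pow_two]
  exact hsq

theorem unitVec_smul {r : ℝ} (hr : 0 < r) (v : n → ℂ) : unitVec ((r : ℂ) • v) = unitVec v := by
  rw [unitVec, unitVec, norm2_smul, smul_smul, Complex.norm_real, Real.norm_eq_abs,
    abs_of_pos hr]
  congr 1
  have : (r : ℂ) ≠ 0 := by exact_mod_cast hr.ne'
  push_cast
  rw [mul_inv, mul_comm, ← mul_assoc, mul_inv_cancel₀ this, one_mul]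

/-- The difference of the unit vectors is `(v - w) / ‖w‖` plus a correction along `v` of norm `|‖w‖
- ‖v‖| / ‖w‖`, and each part is at most `‖v - w‖ / ‖w‖`. -/
theorem norm2_unitVec_sub_le {v w : n → ℂ} (hv : 0 < norm2 v) (hw : 0 < norm2 w) :
    norm2 (unitVec v - unitVec w) ≤ 2 * norm2 (v - w) / norm2 w := by
  have hv' : (norm2 v : ℂ) ≠ 0 := by exact_mod_cast hv.ne'
  have hw' : (norm2 w : ℂ) ≠ 0 := by exact_mod_cast hw.ne'
  have h1 : unitVec v - unitVec w = (norm2 w : ℂ)⁻¹ • (v - w) +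
      (((norm2 w - norm2 v) / (norm2 v * norm2 w) : ℝ) : ℂ) • v := by
    ext i
    simp only [unitVec, Pi.sub_apply, Pi.smul_apply, Pi.add_apply, smul_eq_mul]
    push_cast
    field_simp
    ring
  have h2 : |norm2 w - norm2 v| ≤ norm2 (v - w) := by
    rw [abs_le]
    constructor
    · linarith [norm2_sub_le v w]
    · rw [norm2_sub_comm]; exact norm2_sub_le w v
  have h3 : ∀ x y : n → ℂ, norm2 (x + y) ≤ norm2 x + norm2 y := fun x y => by
    rw [norm2, WithLp.toLp_add]; exact norm_add_le _ _
  rw [h1]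
  refine (h3 _ _).trans ?_
  rw [norm2_smul, norm2_smul, norm_inv, Complex.norm_real, Complex.norm_real, Real.norm_eq_abs,
    Real.norm_eq_abs, abs_of_pos hw, abs_div, abs_of_pos (mul_pos hv hw)]
  have h4 : |norm2 w - norm2 v| / (norm2 v * norm2 w) * norm2 v =
      |norm2 w - norm2 v| / norm2 w := by
    field_simp
  rw [h4, ← div_eq_inv_mul, ← add_div]
  gcongr
  linarith

/-- A polynomial that approximates `1 / (2 κ x)` on the spectrum yields the inverse. -/
theorem norm_polynomial_sub_inv_le [Nonempty n] {M : Matrix n n ℂ} {κ δ : ℝ} (hκ : 0 < κ)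
    (hδ : 0 ≤ δ) (hdet : IsUnit M.det) (hM : ‖M‖ ≤ 1) (hMi : ‖M⁻¹‖ ≤ κ) (a : Polynomial ℝ)
    (ha : ∀ y : ℝ, 1 / κ ^ 2 ≤ y → y ≤ 1 → |2 * κ * (y * a.eval y) - 1| ≤ δ) :
    ‖Mᴴ * Polynomial.aeval (M * Mᴴ) a - ((2 * κ : ℝ) : ℂ)⁻¹ • M⁻¹‖ ≤ δ := by
  set Y := M * Mᴴ with hY
  have hYs : IsSelfAdjoint Y := by
    rw [IsSelfAdjoint, star_eq_conjTranspose, hY, conjTranspose_mul, conjTranspose_conjTranspose]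
  have hYn : ‖Y‖ ≤ 1 := by
    refine (Matrix.l2_opNorm_mul _ _).trans ?_
    rw [Matrix.l2_opNorm_conjTranspose]
    nlinarith [norm_nonneg M]
  have hMM : M * M⁻¹ = 1 := Matrix.mul_nonsing_inv _ hdet
  have hMM' : M⁻¹ * M = 1 := Matrix.nonsing_inv_mul _ hdet
  have hMH : Mᴴ * (M⁻¹)ᴴ = 1 := by rw [← conjTranspose_mul, hMM', conjTranspose_one]
  have hMH' : (M⁻¹)ᴴ * Mᴴ = 1 := by rw [← conjTranspose_mul, hMM, conjTranspose_one]
  obtain ⟨Yu, hYu, hYui⟩ : ∃ Yu : (Matrix n n ℂ)ˣ, (Yu : Matrix n n ℂ) = Y ∧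
      ((Yu⁻¹ : (Matrix n n ℂ)ˣ) : Matrix n n ℂ) = (M⁻¹)ᴴ * M⁻¹ := by
    refine ⟨⟨Y, (M⁻¹)ᴴ * M⁻¹, ?_, ?_⟩, rfl, rfl⟩
    · rw [hY, Matrix.mul_assoc, ← Matrix.mul_assoc Mᴴ, hMH, Matrix.one_mul, hMM]
    · rw [hY, Matrix.mul_assoc, ← Matrix.mul_assoc M⁻¹, hMM', Matrix.one_mul, hMH']
  have hYin : ‖((Yu⁻¹ : (Matrix n n ℂ)ˣ) : Matrix n n ℂ)‖ ≤ κ ^ 2 := by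
    rw [hYui, Matrix.l2_opNorm_conjTranspose_mul_self]
    nlinarith [norm_nonneg M⁻¹]
  -- The norm of `Y` bounds its spectrum from above, and the norm of `Y⁻¹`, at most `κ²`, bounds it
  -- from below.
  have hspec : ∀ y ∈ spectrum ℝ Y, 1 / κ ^ 2 ≤ y ∧ y ≤ 1 := by
    intro y hy
    have h0 : 0 ≤ y := by
      have : Y = star Mᴴ * Mᴴ := by simp [hY, star_eq_conjTranspose]
      rw [this] at hy
      exact spectrum_star_mul_self_nonneg y hy
    have hinv : y⁻¹ ∈ spectrum ℝ ((Yu⁻¹ : (Matrix n n ℂ)ˣ) : Matrix n n ℂ) :=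
      by
      rw [← hYu] at hy
      exact spectrum.inv₀_mem_inv_iff.2 hy
    have hne : y ≠ 0 := fun h => by
      subst h
      rw [← hYu] at hy
      exact (spectrum.zero_notMem_iff ℝ).2 Yu.isUnit hy
    have hpos : 0 < y := lt_of_le_of_ne h0 (Ne.symm hne)
    have b1 : ‖y‖ ≤ ‖Y‖ := spectrum.norm_le_norm_of_mem hy
    have b2 : ‖y⁻¹‖ ≤ ‖((Yu⁻¹ : (Matrix n n ℂ)ˣ) : Matrix n n ℂ)‖ :=
      spectrum.norm_le_norm_of_mem hinv
    rw [Real.norm_eq_abs, abs_of_pos hpos] at b1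
    rw [Real.norm_eq_abs, abs_of_pos (inv_pos.2 hpos)] at b2
    refine ⟨?_, b1.trans hYn⟩
    rw [div_le_iff₀ (by positivity)]
    have b3 := b2.trans hYin
    rw [inv_le_iff_one_le_mul₀ hpos] at b3
    linarith
  set q : Polynomial ℝ := Polynomial.C (2 * κ) * (Polynomial.X * a) - 1 with hq
  have hB : ‖Polynomial.aeval Y q‖ ≤ δ := by
    rw [← cfc_polynomial q Y hYs]
    refine norm_cfc_le hδ fun y hy => ?_
    obtain ⟨h1, h2⟩ := hspec y hy
    simpa [hq] using ha y h1 h2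
  have hκc : ((2 * κ : ℝ) : ℂ) ≠ 0 := by exact_mod_cast (by positivity : (2 * κ : ℝ) ≠ 0)
  -- Since `Mᴴ = M⁻¹ Y`, the error is `M⁻¹` times the scalar error polynomial at the self-adjoint
  -- `Y`. The factor `κ` from `M⁻¹` cancels against `1 / (2 κ)`.
  have heq : Mᴴ * Polynomial.aeval Y a - ((2 * κ : ℝ) : ℂ)⁻¹ • M⁻¹ =
      ((2 * κ : ℝ) : ℂ)⁻¹ • (M⁻¹ * Polynomial.aeval Y q) := by
    have hsm : ∀ r : ℝ, (algebraMap ℝ (Matrix n n ℂ)) r = (r : ℂ) • 1 := fun r => by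
      rw [Algebra.algebraMap_eq_smul_one]
      ext i j
      simp
    rw [hq, map_sub, map_mul (Polynomial.aeval Y), map_mul (Polynomial.aeval Y), map_one,
      Polynomial.aeval_X, Polynomial.aeval_C, hsm,
      smul_mul_assoc, one_mul, hY, Matrix.mul_sub, Matrix.mul_smul, Matrix.mul_assoc M,
      ← Matrix.mul_assoc M⁻¹, hMM', Matrix.one_mul, smul_sub, smul_smul, inv_mul_cancel₀ hκc,
      one_smul, Matrix.mul_one]
  rw [heq, norm_smul, norm_inv, Complex.norm_real, Real.norm_eq_abs, abs_of_pos (by positivity)]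
  calc (2 * κ)⁻¹ * ‖M⁻¹ * Polynomial.aeval Y q‖ ≤ (2 * κ)⁻¹ * (κ * δ) := by
        gcongr
        refine (Matrix.l2_opNorm_mul _ _).trans ?_
        gcongr
    _ = δ / 2 := by field_simp
    _ ≤ δ := by linarith

end Norms

/-! ### Bounds on the number of queries -/

/-- A number of repetitions of order `log (1 / δ)` for accuracy `δ`. -/
theorem exists_pow_le {δ : ℝ} (h0 : 0 < δ) (h1 : δ ≤ 1) :
    ∃ l : ℕ, (80 / 81 : ℝ) ^ l ≤ δ ∧ (l : ℝ) ≤ 81 * Real.log (1 / δ) + 1 := by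
  have hlog : 0 ≤ Real.log (1 / δ) := Real.log_nonneg (by rw [le_div_iff₀ h0]; linarith)
  refine ⟨⌈81 * Real.log (1 / δ)⌉₊, ?_, (Nat.ceil_lt_add_one (by positivity)).le⟩
  set l := ⌈81 * Real.log (1 / δ)⌉₊ with hl
  have hl1 : 81 * Real.log (1 / δ) ≤ l := Nat.le_ceil _
  have h2 : (80 / 81 : ℝ) ≤ Real.exp (-(1 / 81)) := by
    have := Real.add_one_le_exp (-(1 / 81 : ℝ))
    linarith
  calc (80 / 81 : ℝ) ^ l ≤ Real.exp (-(1 / 81)) ^ l := by gcongr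
    _ = Real.exp (-(l / 81)) := by rw [← Real.exp_nat_mul]; ring_nf
    _ ≤ Real.exp (-Real.log (1 / δ)) := by
        apply Real.exp_le_exp.2
        linarith
    _ = δ := by rw [Real.exp_neg, Real.exp_log (by positivity)]; simp

/-- The number of queries of the transformation of the preconditioned block encoding. -/
theorem inverse_length_le {γ κ ε : ℝ} (hγ : 1 ≤ γ) (hκ : 1 ≤ κ) (h0 : 0 < ε) (h1 : ε ≤ 1 / 2)
    {l : ℕ} (hl : (l : ℝ) ≤ 81 * Real.log (1 / (ε / (4 * γ))) + 1) :
    ((2 * ((2 * l + 1) * ⌈3 / 2 * (γ * κ)⌉₊) + 1 : ℕ) : ℝ) ≤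
      6 * γ * (168 + 324 * Real.log (4 * γ)) * (κ * Real.log (1 / ε)) := by
  have hL : 1 / 2 ≤ Real.log (1 / ε) := by
    have h2 : Real.log 2 ≤ Real.log (1 / ε) := by
      apply Real.log_le_log (by norm_num)
      rw [le_div_iff₀ h0]
      linarith
    linarith [Real.log_two_gt_d9]
  have hsplit : Real.log (1 / (ε / (4 * γ))) = Real.log (1 / ε) + Real.log (4 * γ) := by
    rw [← Real.log_mul (by positivity) (by positivity)]
    congr 1
    field_simp
  rw [hsplit] at hl
  have hg : 0 ≤ Real.log (4 * γ) := Real.log_nonneg (by linarith)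
  have hγκ : 1 ≤ γ * κ := by nlinarith
  have hN : (⌈3 / 2 * (γ * κ)⌉₊ : ℝ) ≤ 5 / 2 * (γ * κ) := by
    have := (Nat.ceil_lt_add_one (show 0 ≤ 3 / 2 * (γ * κ) by positivity)).le
    linarith
  -- The bound `log (1 / ε) ≥ 1 / 2` absorbs the terms without this logarithm: the constant `3`
  -- contributes `6` (so `168 = 162 + 6`), and `162 log (4 γ)` doubles to `324 log (4 γ)`.
  have h3 : (2 * l + 1 : ℝ) ≤ (168 + 324 * Real.log (4 * γ)) * Real.log (1 / ε) := by
    nlinarith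
  have h4 : (0 : ℝ) ≤ 2 * l + 1 := by positivity
  push_cast
  calc 2 * ((2 * (l : ℝ) + 1) * (⌈3 / 2 * (γ * κ)⌉₊ : ℝ)) + 1
      ≤ 2 * ((2 * (l : ℝ) + 1) * (5 / 2 * (γ * κ))) + (2 * (l : ℝ) + 1) * (γ * κ) := by
        have h5 : (1 : ℝ) ≤ (2 * (l : ℝ) + 1) * (γ * κ) := by
          have : (0 : ℝ) ≤ l := Nat.cast_nonneg l
          nlinarith
        gcongr
    _ = (2 * (l : ℝ) + 1) * (6 * (γ * κ)) := by ring
    _ ≤ ((168 + 324 * Real.log (4 * γ)) * Real.log (1 / ε)) * (6 * (γ * κ)) := by gcongr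
    _ = 6 * γ * (168 + 324 * Real.log (4 * γ)) * (κ * Real.log (1 / ε)) := by ring

end QLS

/-! ### The complete algorithm -/

open QLS in
theorem mainTheorem4 (c : ℝ) (hc : 1 < c) :
    ∃ K : ℝ, 0 < K ∧
      ∀ (d D : ℕ) [NeZero d] (G : Matrix (Fin D) (Fin d) ℂ), QLS.IsIso G →
      ∀ αA αinv t ε : ℝ, 0 < αA → 0 < αinv → 1 ≤ αA * αinv → 0 < t → 0 < ε → ε ≤ 1 / 2 →
      -- the algorithm depends only on the known data `d`, `D`, `G`, `αA`, `αinv`, `t`, `ε`, `c`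
      ∃ (y : ℕ) (G' : Matrix (Fin y) (Fin d) ℂ) (hG' : QLS.IsIso G')
        -- a circuit with queries to `O_A`, `O_b` for the preconditioned coefficient matrix
        (P : QLS.Circuit (Fin D) (Fin d) (Fin y))
        -- the phases of a QSVT sequence with queries to the block encoding implemented by `P`
        (Φ : List ℝ) (w : ℕ)
        -- the state preparation with queries to the block encoded inverse and to `O_b`
        (T : QLS.Circuit (Fin y × Fin 2) (Fin d) (Fin d × Fin (w + 1))),
        let Q : QLS.Circuit (Fin D) (Fin d) (Fin y × Fin 2) :=
          QLS.Circuit.subst P (QLS.qsvt hG' true Φ)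
        let alg : QLS.Circuit (Fin D) (Fin d) (Fin d × Fin (w + 1)) := QLS.Circuit.subst Q T
        let s : ℝ := t / (c * αinv)
        QLS.Circuit.queries₁ P = 1 ∧ QLS.Circuit.queries₂ P = 2 ∧ Odd Φ.length ∧
        (QLS.Circuit.queries₁ alg : ℝ) ≤ K * (αA * αinv * Real.log (1 / ε)) ∧
        (QLS.Circuit.queries₂ alg : ℝ) ≤ K * (αA * αinv * Real.log (1 / ε)) ∧
        ∀ (A : Matrix (Fin d) (Fin d) ℂ) (OA : Matrix (Fin D) (Fin D) ℂ)
          (Ob : Matrix (Fin d) (Fin d) ℂ) (b : Fin d → ℂ),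
          QLS.BlockEncodes G OA αA A →
          Ob ∈ Matrix.unitaryGroup (Fin d) ℂ → Ob *ᵥ Pi.single 0 1 = b →
          IsUnit A.det → ‖A⁻¹‖ ≤ αinv →
          t / c < QLS.norm2 (A⁻¹ *ᵥ b) → QLS.norm2 (A⁻¹ *ᵥ b) < c * t →
          let SA : Matrix (Fin d) (Fin d) ℂ := QLS.scaling s b * A
          -- `s = Θ(√p_succ)`
          (QLS.norm2 (A⁻¹ *ᵥ b) / αinv / c ^ 2 < s ∧ s < QLS.norm2 (A⁻¹ *ᵥ b) / αinv ∧ s < 1) ∧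
          -- the preconditioned system is nonsingular and has the same solution state
          IsUnit SA.det ∧ QLS.unitVec (SA⁻¹ *ᵥ b) = QLS.unitVec (A⁻¹ *ᵥ b) ∧
          -- `SA / αA` is block encoded by `P`
          QLS.BlockEncodes G' (QLS.Circuit.op OA Ob P) αA SA ∧
          -- the QSVT sequence block encodes the inverse of `SA` to accuracy `ε`
          ‖SA⁻¹‖ ≤ Real.sqrt (c ^ 4 + 1) * αinv ∧
          QLS.ApproxBlockEncodes (QLS.plusIso G') (QLS.Circuit.op OA Ob Q)
            (((2 * (Real.sqrt (c ^ 4 + 1) * αinv) : ℝ) : ℂ)⁻¹ • SA⁻¹) ε ∧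
          -- the solution state is prepared
          QLS.Prepares (QLS.Circuit.op OA Ob alg) (QLS.unitVec (A⁻¹ *ᵥ b)) ε (1 / 2) := by
  set γ : ℝ := Real.sqrt (c ^ 4 + 1) with hγdef
  have hc4 : 1 ≤ c ^ 4 := one_le_pow₀ hc.le
  have hγsq : γ ^ 2 = c ^ 4 + 1 := Real.sq_sqrt (by positivity)
  have hγ0 : 0 ≤ γ := Real.sqrt_nonneg _
  have hγ1 : 1 ≤ γ := by nlinarith
  have hγpos : 0 < γ := by linarith
  -- `1 / (4 γ)` bounds from below the amplitude left after inversion. It depends on `c` only, hence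
  -- so does the degree of `aT`, which governs the number of amplification rounds.
  obtain ⟨aT, haT, haT'⟩ := exists_sign_polynomial (1 / (4 * γ)) (by positivity)
  set nT : ℕ := 2 * aT.natDegree + 1 with hnT
  set Cn : ℝ := 6 * γ * (168 + 324 * Real.log (4 * γ)) with hCn
  have hg : 0 ≤ Real.log (4 * γ) := Real.log_nonneg (by linarith)
  -- Each of the `nT` uses of the encoded inverse makes `2 * Φ.length` queries to `O_b`; the
  -- amplification itself makes `nT` more, which a third `nT * Φ.length` covers.
  refine ⟨3 * nT * Cn, by positivity, ?_⟩
  intro d D _ G hG αA αinv t ε hαA hαinv hκ ht hε0 hε1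
  have : Nonempty (Fin d) := ⟨0⟩
  set κ : ℝ := γ * (αA * αinv) with hκdef
  have hκ0 : 0 < κ := by positivity
  have hκ2 : 2 ≤ κ ^ 2 := by
    have h1 : 1 ≤ (αA * αinv) ^ 2 := one_le_pow₀ hκ
    rw [hκdef, mul_pow, hγsq]
    nlinarith
  -- Normalizing a vector of norm at least `1 / (2 γ)` magnifies an error by at most `4 γ`.
  set δ : ℝ := ε / (4 * γ) with hδdef
  have hδ0 : 0 < δ := by positivity
  have hδγ : δ * (4 * γ) = ε := by rw [hδdef]; field_simp
  have hδε : δ ≤ ε := div_le_self hε0.le (by linarith)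
  obtain ⟨l, hl1, hl2⟩ := exists_pow_le hδ0 (by linarith)
  obtain ⟨a, hadeg, habd, haapp⟩ := exists_inverse_polynomial κ hκ0 hκ2 l
  obtain ⟨Φ, hΦlen, hΦ⟩ := exists_qsvt _ a hadeg habd
  -- The circuit is fixed before the promise on `t` is available, and the dilation needs `s ≤ 1`.
  -- The promise later gives `s < 1`, so the cap has no effect.
  set s₀ : ℝ := min (t / (c * αinv)) 1 with hs₀
  have hspos : 0 < t / (c * αinv) := by positivity
  obtain ⟨y, G', hG', P, hy, hP1, hP2, hP⟩ := exists_scaled_block_encoding hG s₀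
    (pow_le_one₀ (lt_min hspos one_pos).le (min_le_right _ _))
  have : Nonempty (Fin y) := ⟨⟨0, Nat.pos_of_ne_zero hy⟩⟩
  obtain ⟨w, T, hT1, hT2, hT⟩ := exists_amplification_circuit (isIso_plusIso hG') aT haT
  refine ⟨y, G', hG', P, Φ, w, T, ?_⟩
  intro Q alg s
  have hnΦ : (Φ.length : ℝ) ≤ Cn * (αA * αinv * Real.log (1 / ε)) := by
    rw [hΦlen]
    exact inverse_length_le hγ1 hκ hε0 hε1 hl2
  have hnT1 : (1 : ℝ) ≤ nT := by
    rw [hnT]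
    exact_mod_cast Nat.le_add_left 1 _
  have hQ1 : Circuit.queries₁ Q = Φ.length := by
    simp only [Q, Circuit.queries₁_subst, queries₁_qsvt, hP1, mul_one]
  have hQ2 : Circuit.queries₂ Q = Φ.length * 2 := by
    simp only [Q, Circuit.queries₂_subst, queries₁_qsvt, queries₂_qsvt, hP2, add_zero]
  have hΦ1 : (1 : ℝ) ≤ Φ.length := by
    rw [hΦlen]; exact_mod_cast Nat.le_add_left 1 _
  refine ⟨hP1, hP2, ⟨_, hΦlen⟩, ?_, ?_, ?_⟩
  · have : Circuit.queries₁ alg = nT * Φ.length := by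
      simp only [alg, Circuit.queries₁_subst, hT1, hQ1, hnT]
    rw [this]
    push_cast
    calc (nT : ℝ) * Φ.length ≤ 3 * nT * Φ.length := by gcongr; linarith
      _ ≤ 3 * nT * (Cn * (αA * αinv * Real.log (1 / ε))) := by gcongr
      _ = 3 * nT * Cn * (αA * αinv * Real.log (1 / ε)) := by ring
  · have : Circuit.queries₂ alg = nT * (Φ.length * 2) + nT := by
      simp only [alg, Circuit.queries₂_subst, hT1, hT2, hQ2, hnT]
    rw [this]
    push_cast
    calc (nT : ℝ) * (Φ.length * 2) + nT ≤ 3 * nT * Φ.length := by nlinarith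
      _ ≤ 3 * nT * (Cn * (αA * αinv * Real.log (1 / ε))) := by gcongr
      _ = 3 * nT * Cn * (αA * αinv * Real.log (1 / ε)) := by ring
  intro A OA Ob b hA hOb hb hdet hAinv hx1 hx2 SA
  obtain ⟨-, hOA, hAeq⟩ := hA
  set x : Fin d → ℂ := A⁻¹ *ᵥ b with hxdef
  have hbnorm : norm2 b = 1 := by
    rw [← hb, norm2_mulVec_of_isIso (Matrix.mem_unitaryGroup_iff'.1 hOb), norm2_single]
  have hbb : star b ⬝ᵥ b = 1 := by rw [← norm2_sq, hbnorm]; simp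
  have hxle : norm2 x ≤ αinv := by
    have := norm2_mulVec_le A⁻¹ b
    rw [hbnorm, mul_one] at this
    exact this.trans hAinv
  have hs_lt : s < norm2 x / αinv := by
    rw [show s = t / c / αinv by simp only [s]; field_simp]
    gcongr
  have hs1 : s < 1 := hs_lt.trans_le (by rw [div_le_one hαinv]; exact hxle)
  have hs0 : 0 < s := hspos
  have hs₀s : s₀ = s := min_eq_left hs1.le
  have hs_gt : norm2 x / αinv / c ^ 2 < s := by
    rw [show s = c * t / αinv / c ^ 2 by simp only [s]; field_simp]
    gcongr
  have hSS : scaling s b * scaling s⁻¹ b = 1 := scaling_mul_scaling_inv hbb hs0.ne'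
  have hSdet : IsUnit (scaling s b).det :=
    (Matrix.isUnit_iff_isUnit_det _).1 (IsUnit.of_mul_eq_one _ hSS)
  have hSinv : (scaling s b)⁻¹ = scaling s⁻¹ b := Matrix.inv_eq_right_inv hSS
  have hSAdet : IsUnit SA.det := by
    simp only [SA, Matrix.det_mul]
    exact hSdet.mul hdet
  have hSAinv : SA⁻¹ = A⁻¹ * scaling s⁻¹ b := by
    simp only [SA, Matrix.mul_inv_rev, hSinv]
  have hSAb : SA⁻¹ *ᵥ b = ((s⁻¹ : ℝ) : ℂ) • x := by
    rw [hSAinv, ← Matrix.mulVec_mulVec, scaling_mulVec_self hbb, Matrix.mulVec_smul]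
  have hSAnorm : ‖SA⁻¹‖ ≤ γ * αinv := by
    rw [hSAinv, hγdef, show c ^ 4 + 1 = (c ^ 2) ^ 2 + 1 by ring]
    refine norm_mul_scaling_le hbb _ hAinv ?_ hαinv.le
    rw [abs_of_pos (inv_pos.2 hs0), inv_mul_le_iff₀ hs0]
    rw [div_div, div_lt_iff₀ (by positivity)] at hs_gt
    exact hs_gt.le.trans_eq (by ring)
  have hop : ((αA : ℂ)⁻¹ • SA) = G'ᴴ * Circuit.op OA Ob P * G' := by
    rw [hP OA hOA Ob hOb, hb, hs₀s, ← hAeq, Matrix.mul_smul]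
  have hPu : Circuit.op OA Ob P ∈ Matrix.unitaryGroup (Fin y) ℂ := Circuit.op_unitary hOA hOb P
  have hQu : Circuit.op OA Ob Q ∈ Matrix.unitaryGroup (Fin y × Fin 2) ℂ :=
    Circuit.op_unitary hOA hOb Q
  have hαAc : (αA : ℂ) ≠ 0 := by exact_mod_cast hαA.ne'
  set M : Matrix (Fin d) (Fin d) ℂ := (αA : ℂ)⁻¹ • SA with hM
  have hMdet : IsUnit M.det := by
    rw [hM, Matrix.det_smul]
    exact (((isUnit_iff_ne_zero.2 (inv_ne_zero hαAc)).pow _)).mul hSAdet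
  have hMinv : M⁻¹ = (αA : ℂ) • SA⁻¹ := by
    refine Matrix.inv_eq_right_inv ?_
    rw [hM, smul_mul_smul_comm, inv_mul_cancel₀ hαAc, Matrix.mul_nonsing_inv _ hSAdet, one_smul]
  have hMnorm : ‖M‖ ≤ 1 := by rw [hop]; exact norm_conj_isIso_le_one hG' hPu
  have hMinvnorm : ‖M⁻¹‖ ≤ κ := by
    rw [hMinv, norm_smul, Complex.norm_real, Real.norm_eq_abs, abs_of_pos hαA, hκdef,
      mul_left_comm]
    exact mul_le_mul_of_nonneg_left hSAnorm hαA.le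
  set B : Matrix (Fin d) (Fin d) ℂ := (plusIso G')ᴴ * Circuit.op OA Ob Q * plusIso G' with hB
  set R : Matrix (Fin d) (Fin d) ℂ := ((2 * (γ * αinv) : ℝ) : ℂ)⁻¹ • SA⁻¹ with hR
  have hBR : ‖B - R‖ ≤ δ := by
    -- The sequence starts with an inverse query and so transforms `Mᴴ`; its singular vectors are
    -- paired as those of `M⁻¹`, which is why `Mᴴ a(M Mᴴ)` can approximate the inverse.
    have hZ : G'ᴴ * dirOp true (Circuit.op OA Ob P) * G' = Mᴴ := by
      rw [hop]
      simp [dirOp, Matrix.mul_assoc]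
    have e1 : B = Mᴴ * Polynomial.aeval (M * Mᴴ) a := by
      have := hΦ hG' hPu Ob true
      rw [hZ, conjTranspose_conjTranspose, ← Circuit.op_subst] at this
      exact this
    have e2 : R = ((2 * κ : ℝ) : ℂ)⁻¹ • M⁻¹ := by
      rw [hR, hMinv, smul_smul]
      congr 1
      have h1 : (γ : ℂ) ≠ 0 := by exact_mod_cast hγpos.ne'
      have h2 : (αinv : ℂ) ≠ 0 := by exact_mod_cast hαinv.ne'
      rw [hκdef]
      push_cast
      field_simp
    rw [e1, e2]
    exact (norm_polynomial_sub_inv_le hκ0 (by positivity) hMdet hMnorm hMinvnorm a haapp).trans hl1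
  refine ⟨⟨hs_gt, hs_lt, hs1⟩, hSAdet, ?_, ⟨hG', hPu, hop⟩, hSAnorm,
    ⟨isIso_plusIso hG', hQu, hBR.trans hδε⟩, ?_⟩
  · rw [hSAb, unitVec_smul (inv_pos.2 hs0)]
  set v : Fin d → ℂ := B *ᵥ b with hv
  have hRb : R *ᵥ b = (((2 * (γ * αinv))⁻¹ * s⁻¹ : ℝ) : ℂ) • x := by
    rw [hR, Matrix.smul_mulVec, hSAb, smul_smul]
    push_cast
    rfl
  have hRpos : 0 < (2 * (γ * αinv))⁻¹ * s⁻¹ := by positivity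
  -- The gain from preconditioning: `s * αinv < ‖x‖` bounds the amplitude of the solution from below
  -- independently of `κ`.
  have hRnorm : 1 / (2 * γ) ≤ norm2 (R *ᵥ b) := by
    rw [hRb, norm2_smul, Complex.norm_real, Real.norm_eq_abs, abs_of_pos hRpos]
    rw [lt_div_iff₀ hαinv] at hs_lt
    calc 1 / (2 * γ) = (2 * (γ * αinv))⁻¹ * s⁻¹ * (s * αinv) := by field_simp
      _ ≤ (2 * (γ * αinv))⁻¹ * s⁻¹ * norm2 x := by gcongr
  have hdiff : norm2 (v - R *ᵥ b) ≤ δ := by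
    have := norm2_mulVec_le (B - R) b
    rw [hbnorm, mul_one, Matrix.sub_mulVec] at this
    exact this.trans hBR
  have hδ8 : δ ≤ 1 / (4 * γ) := by
    rw [hδdef]
    gcongr
    linarith
  have hsum : 1 / (2 * γ) = 1 / (4 * γ) + 1 / (4 * γ) := by field_simp; norm_num
  have hvlow : 1 / (4 * γ) ≤ norm2 v := by
    have := norm2_sub_le (R *ᵥ b) v
    rw [norm2_sub_comm] at this
    linarith
  have hvup : norm2 v ≤ 1 := by
    have := norm2_mulVec_le B b
    rw [hbnorm, mul_one] at this
    exact this.trans (norm_conj_isIso_le_one (isIso_plusIso hG') hQu)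
  have hvpos : 0 < norm2 v := lt_of_lt_of_le (by positivity) hvlow
  have hflag : flaggedState (Circuit.op OA Ob alg) = ((aT.eval (norm2 v ^ 2) : ℝ) : ℂ) • v := by
    simp only [alg, Circuit.op_subst]
    exact hT _ hQu Ob hOb v (by rw [hv, hb])
  have hamp := haT' (norm2 v) hvlow hvup
  have hapos : 0 < aT.eval (norm2 v ^ 2) := by
    refine pos_of_mul_pos_right (lt_of_lt_of_le ?_ hamp) hvpos.le
    norm_num
  refine ⟨?_, ?_⟩
  -- The amplified amplitude is at least `4 / 5`, and `(4 / 5)² = 16 / 25` exceeds `1 / 2`.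
  · rw [hflag, norm2_smul, Complex.norm_real, Real.norm_eq_abs, abs_of_pos hapos, mul_comm]
    exact lt_of_lt_of_le (by norm_num) (pow_le_pow_left₀ (by norm_num) hamp 2)
  · rw [hflag, unitVec_smul hapos, ← unitVec_smul hRpos x, ← hRb]
    have hRb0 : 0 < norm2 (R *ᵥ b) := lt_of_lt_of_le (by positivity) hRnorm
    refine (norm2_unitVec_sub_le hvpos hRb0).trans ?_
    rw [div_le_iff₀ hRb0]
    calc 2 * norm2 (v - R *ᵥ b) ≤ 2 * δ := by gcongr
      _ = ε * (1 / (2 * γ)) := by rw [← hδγ]; field_simp; norm_num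
      _ ≤ ε * norm2 (R *ᵥ b) := by gcongr
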